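/- For real $s$ let $L^{2,s}(\mathbb R)=\{f:\ (1+|x|^2)^{s/2}f\in L^2(\mathbb R)\}$ with norm $\|f\|_{L^{2,s}}=\|(1+|x|^2)^{s/2}f\|_{L^2}$, and let $H^{2,s}(\mathbb R)$ be the space of functions whose weak derivatives of order $0,1,2$ lie in $L^{2,s}(\mathbb R)$, with norm $\|f\|_{H^{2,s}}=\|(1+|x|^2)^{s/2}f\|_{H^2}$ (functions are complex-valued). For a real potential $V$ let $H_V=-\partial_x^2+V$ on $L^2(\mathbb R)$ with domain $H^2(\mathbb R)$. For $a,b,\mu\in\mathbb R$ let $\mathcal A_1(a,b,\mu)$ be the set of real $V\in H^1(\mathbb R)$ with $V=0$ for $|x|>a$ and $\|V\|_{H^1}\le b$ such that $H_V$ has exactly one negative eigenvalue $\lambda_V$, and $\sqrt{\lambda_V+\mu}>0$. Call $V$ exceptional if $-\eta''+V\eta=0$ has a nontrivial bounded solution $\eta$ (a half-bound state at zero energy); for compactly supported $V$ this says that the solutions $\eta_\pm$ of $-\eta''+V\eta=0$ with $\eta_\pm\to1$ as $x\to\pm\infty$ have Wronskian $0$. For $k\in\mathbb R$ and $f\in L^{2,s}(\mathbb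 R)$, $s>\tfrac12$, the outgoing resolvent is $$R_V(k)f=\lim_{\kappa\to k,\ \operatorname{Im}\kappa>0}(H_V-\kappa^2)^{-1}f\qquad\text{in }L^2_{\mathrm{loc}}(\mathbb R).$$ **Proposition.** Fix $a,b,\mu\in\mathbb R$ and a non-exceptional $V\in\mathcal A_1(a,b,\mu)$, and for $\rho>0$ let $B^\infty(V,\rho)=\{U\in\mathcal A_1(a,b,\mu):\ \|V-U\|_\infty<\rho\}$. There is $\rho_0>0$ such that for every $U\in B^\infty(V,\rho_0)$, every $s>\tfrac12$ and every $k\in\mathbb R$, the limits $R_V(k)f$ and $R_U(k)f$ exist for all $f\in L^{2,s}(\mathbb R)$, the operator $R_V(k)-R_U(k)$ maps $L^{2,s}(\mathbb R)$ to $H^{2,-s}(\mathbb R)$, and $$\|R_V(k)-R_U(k)\|_{L^{2,s}\to H^{2,-s}}\le C\,\|V-U\|_\infty ,$$ where the constant $C=C(V,\rho_0,a,s)$ depends neither on $k$ nor on $U$. -/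

import Mathlib

open MeasureTheory Filter Topology
open scoped ContDiff

/-- `v` is the weak derivative of `u` on the real line. -/
def HasWeakDeriv {E : Type*} [NormedAddCommGroup E] [NormedSpace ℝ E] (u v : ℝ → E) : Prop :=
  LocallyIntegrable u volume ∧ LocallyIntegrable v volume ∧
    ∀ φ : ℝ → ℝ, ContDiff ℝ ∞ φ → HasCompactSupport φ →
      ∫ x, deriv φ x • u x = -∫ x, φ x • v x

open Classical in
/-- A choice of the weak derivative of `u` (unique almost everywhere), and `0` if there is none. -/
noncomputable def weakDeriv {E : Type*} [NormedAddCommGroup E] [NormedSpace ℝ E]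
    (u : ℝ → E) : ℝ → E :=
  if h : ∃ v, HasWeakDeriv u v then h.choose else 0

/-- `u` has weak derivatives up to order `k`. -/
def HasWeakDerivsUpTo {E : Type*} [NormedAddCommGroup E] [NormedSpace ℝ E]
    (k : ℕ) (u : ℝ → E) : Prop :=
  ∀ j < k, HasWeakDeriv (weakDeriv^[j] u) (weakDeriv^[j + 1] u)

/-- `u` belongs to the Sobolev space `H^k(ℝ)`. -/
def MemSobolevSpace {E : Type*} [NormedAddCommGroup E] [NormedSpace ℝ E]
    (k : ℕ) (u : ℝ → E) : Prop :=
  HasWeakDerivsUpTo k u ∧ ∀ j ≤ k, MemLp (weakDeriv^[j] u) 2 volume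

/-- The norm of `H^k(ℝ)`: the square root of the sum of `‖∂^j u‖²` in `L²` over `j ≤ k`. -/
noncomputable def sobolevNorm {E : Type*} [NormedAddCommGroup E] [NormedSpace ℝ E]
    (k : ℕ) (u : ℝ → E) : ℝ :=
  √(∑ j ∈ Finset.range (k + 1), lpNorm (weakDeriv^[j] u) 2 volume ^ 2)

/-- The function `(1 + |x|²)^(s/2) u(x)`. -/
noncomputable def weighted (s : ℝ) (u : ℝ → ℂ) (x : ℝ) : ℂ :=
  (((1 + |x| ^ 2) ^ (s / 2) : ℝ) : ℂ) * u x

/-- `u` belongs to the weighted space `L^{2,s}(ℝ)`. -/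
def MemWeightedL2 (s : ℝ) (u : ℝ → ℂ) : Prop :=
  MemLp (weighted s u) 2 volume

/-- The norm of `L^{2,s}(ℝ)`. -/
noncomputable def weightedL2Norm (s : ℝ) (u : ℝ → ℂ) : ℝ :=
  lpNorm (weighted s u) 2 volume

/-- `u` belongs to the weighted Sobolev space `H^{k,s}(ℝ)`: its weak derivatives up to order `k`
exist and lie in `L^{2,s}(ℝ)`. -/
def MemWeightedSobolev (k : ℕ) (s : ℝ) (u : ℝ → ℂ) : Prop :=
  HasWeakDerivsUpTo k u ∧ ∀ j ≤ k, MemWeightedL2 s (weakDeriv^[j] u)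

/-- The norm of `H^{k,s}(ℝ)`, that is `‖(1 + |x|²)^(s/2) u‖` in `H^k(ℝ)`. -/
noncomputable def weightedSobolevNorm (k : ℕ) (s : ℝ) (u : ℝ → ℂ) : ℝ :=
  sobolevNorm k (weighted s u)

/-- `T` maps `L^{2,s}(ℝ)` to `H^{k,r}(ℝ)` with `‖T f‖ ≤ M ‖f‖`, i.e. its operator norm is at
most `M`. -/
def OpNormLE (s : ℝ) (k : ℕ) (r : ℝ) (T : (ℝ → ℂ) → (ℝ → ℂ)) (M : ℝ) : Prop :=
  ∀ f : ℝ → ℂ, MemWeightedL2 s f →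
    MemWeightedSobolev k r (T f) ∧ weightedSobolevNorm k r (T f) ≤ M * weightedL2Norm s f

/-- `u ∈ H²(ℝ)`, the domain of `H_V = -∂ₓ² + V`, and `(H_V - z) u = f`. -/
def SolvesSchrodinger (V : ℝ → ℝ) (z : ℂ) (f u : ℝ → ℂ) : Prop :=
  MemSobolevSpace 2 u ∧
    ∀ᵐ x, -(weakDeriv^[2] u x) + (V x : ℂ) * u x - z * u x = f x

/-- `l` is an eigenvalue of `H_V` on `L²(ℝ)`. -/
def IsSchrodingerEigenvalue (V : ℝ → ℝ) (l : ℝ) : Prop :=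
  ∃ ψ : ℝ → ℂ, ¬ ψ =ᵐ[volume] 0 ∧ SolvesSchrodinger V (l : ℂ) 0 ψ

/-- The class `A₁(a, b, μ)` of admissible potentials. -/
structure IsAdmissible (a b μ : ℝ) (V : ℝ → ℝ) : Prop where
  support_subset : ∀ᵐ x : ℝ, a < |x| → V x = 0
  memSobolev : MemSobolevSpace 1 V
  norm_le : sobolevNorm 1 V ≤ b
  eigenvalue : ∃ l : ℝ, l < 0 ∧ IsSchrodingerEigenvalue V l ∧
    (∀ l' : ℝ, l' < 0 → IsSchrodingerEigenvalue V l' → l' = l) ∧ 0 < √(l + μ)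

/-- The norm `‖V - U‖` in `L^∞(ℝ)`. -/
noncomputable def supDist (V U : ℝ → ℝ) : ℝ :=
  lpNorm (V - U) ⊤ volume

/-- The ball `B^∞(V, ρ)` in `A₁(a, b, μ)`. -/
def admissibleBall (a b μ : ℝ) (V : ℝ → ℝ) (ρ : ℝ) : Set (ℝ → ℝ) :=
  {U | IsAdmissible a b μ U ∧ supDist V U < ρ}

/-- `V` is exceptional: `H_V` has a half-bound state (zero energy resonance), a nontrivial bounded
solution `η` of `-η'' + V η = 0`. For `V` of compact support this says that the solutions `η_±`
of this equation that tend to `1` at `±∞` are linearly dependent, i.e. have Wronskian `0`. -/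
def IsExceptional (V : ℝ → ℝ) : Prop :=
  ∃ η η' : ℝ → ℂ, MemLp η ⊤ volume ∧ ¬ η =ᵐ[volume] 0 ∧
    HasWeakDeriv η η' ∧ HasWeakDeriv η' (fun x => (V x : ℂ) * η x)

/-- `z` is in the resolvent set of `H_V`: the map `H_V - z` from `H²(ℝ)` to `L²(ℝ)` is
bijective. -/
def InResolventSet (V : ℝ → ℝ) (z : ℂ) : Prop :=
  ∀ f : ℝ → ℂ, MemLp f 2 volume →
    (∃ u, SolvesSchrodinger V z f u) ∧
      ∀ u w, SolvesSchrodinger V z f u → SolvesSchrodinger V z f w → u =ᵐ[volume] w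

open Classical in
/-- `(H_V - z)⁻¹ f`, for `z` in the resolvent set and `f ∈ L²(ℝ)`. -/
noncomputable def schrodingerResolvent (V : ℝ → ℝ) (z : ℂ) (f : ℝ → ℂ) : ℝ → ℂ :=
  if h : ∃ u, SolvesSchrodinger V z f u then h.choose else 0

/-- `ψ` is the limit of `(H_V - κ²)⁻¹ f` in `L²_loc(ℝ)` as `κ → k` with `Im κ > 0`. -/
def IsOutgoingLimit (V : ℝ → ℝ) (k : ℝ) (f ψ : ℝ → ℂ) : Prop :=
  (∀ᶠ κ in 𝓝[{κ : ℂ | 0 < κ.im}] (k : ℂ), InResolventSet V (κ ^ 2)) ∧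
  ∀ r : ℝ, MemLp ψ 2 (volume.restrict (Set.Icc (-r) r)) ∧
    Tendsto (fun κ : ℂ => eLpNorm (schrodingerResolvent V (κ ^ 2) f - ψ) 2
      (volume.restrict (Set.Icc (-r) r))) (𝓝[{κ : ℂ | 0 < κ.im}] (k : ℂ)) (𝓝 0)

open Classical in
/-- The outgoing resolvent `R_V(k)` at real `k`, defined by limiting absorption (and `0` at those
`f` for which the limit does not exist). -/
noncomputable def outgoingResolvent (V : ℝ → ℝ) (k : ℝ) (f : ℝ → ℂ) : ℝ → ℂ :=
  if h : ∃ ψ, IsOutgoingLimit V k f ψ then h.choose else 0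

/-! For a continuous compactly supported potential the resolvent is explicit. Let $m$ and $p$ be the
Jost solutions of $-y''+Vy=\kappa^2y$ equal to $e^{-i\kappa x}$ far to the left and $e^{i\kappa x}$
far to the right, and let $W_V(\kappa)$ be their Wronskian. For $\operatorname{Im}\kappa>0$ and
$W_V(\kappa)\ne0$, $(H_V-\kappa^2)^{-1}$ has kernel $p(\max(x,y))\,m(\min(x,y))/W_V(\kappa)$. The
formula survives at real $k$ when $W_V(k)\ne0$, and dominated convergence identifies it with the
outgoing limit (`isOutgoingLimit_green`).

Uniformity rests on the lower bound $|W_U(k)|\ge c(1+|k|)$ for all real $k$ and all $U$ near $V$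
(`exists_norm_jostWronskian_ge`). Away from $k=0$ it is the universal inequality $|W_U(k)|\ge2|k|$,
which comes from conservation of the Wronskian of $\bar m$ and $m$. Near $k=0$ it follows from
$W_V(0)\ne0$, which is non-exceptionality, and from joint continuity of $m$ in potential and
frequency.

An energy estimate bounds the Jost solutions independently of $k$, so the Green function is
$O((1+|k|)^{-1})$ on the region containing the supports. The second resolvent identity
$R_V-R_U=R_U(U-V)R_V$ contains two such factors, and the gain $(1+|k|)^{-2}$ pays for the $k^2$ in
$u''=(U-k^2)u-g$. Since $g=(U-V)R_Vf$ has compact support, $u$, $u'$, $u''$ are bounded on the whole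
line by a constant times $\|V-U\|_\infty\|f\|_{L^1}$ (`exists_bound_green_sub_green`). The condition
$s>\tfrac12$ embeds $L^{2,s}$ into $L^1$ and puts bounded functions into $L^{2,-s}$. -/

/-! ### Calculus of indefinite integrals -/

/-- `u` is an indefinite integral of the locally integrable function `v`. -/
def IsPrimitive {E : Type*} [NormedAddCommGroup E] [NormedSpace ℝ E] (u v : ℝ → E) : Prop :=
  LocallyIntegrable v volume ∧ ∀ a b, u b - u a = ∫ x in a..b, v x

theorem MeasureTheory.LocallyIntegrable.intervalIntegrable' {E : Type*} [NormedAddCommGroup E]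
    {v : ℝ → E} (hv : LocallyIntegrable v volume) (a b : ℝ) :
    IntervalIntegrable v volume a b :=
  (hv.integrableOn_isCompact isCompact_uIcc).intervalIntegrable

/-- Fubini on the triangle $a<t\le x\le b$: for fixed $t$ the integral of $p'$ over $[t,b]$ is
$p(b)-p(t)$. This is integration by parts when one factor is only absolutely continuous. -/
theorem intervalIntegral_smul_primitive {𝕜 E : Type*} [RCLike 𝕜] [NormedAddCommGroup E]
    [NormedSpace ℝ E] [NormedSpace 𝕜 E] [SMulCommClass ℝ 𝕜 E] [CompleteSpace E]
    {p p' : ℝ → 𝕜} {v : ℝ → E} (hp : ∀ x, HasDerivAt p (p' x) x) (hp' : Continuous p')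
    (hv : LocallyIntegrable v volume) {a b : ℝ} (hab : a ≤ b) :
    ∫ x in a..b, p' x • ∫ t in a..x, v t = ∫ t in a..b, (p b - p t) • v t := by
  have key := intervalIntegral_integral_swap (μ := volume.restrict (Set.Ioc a b)) (a := a) (b := b)
    (f := fun x t => Set.indicator {z : ℝ × ℝ | z.2 ≤ z.1} (fun z => p' z.1 • v z.2) (x, t)) ?_
  · rw [intervalIntegral.integral_of_le hab, intervalIntegral.integral_of_le hab] at *
    convert key using 1
    · refine setIntegral_congr_fun measurableSet_Ioc fun x hx => ?_
      have h1 : (fun t => Set.indicator {z : ℝ × ℝ | z.2 ≤ z.1} (fun z => p' z.1 • v z.2) (x, t))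
          = Set.indicator (Set.Iic x) (fun t => p' x • v t) := by
        ext t; simp [Set.indicator]
      simp only [h1]
      rw [integral_indicator measurableSet_Iic, Measure.restrict_restrict measurableSet_Iic,
        Set.inter_comm, Set.Ioc_inter_Iic, min_eq_right hx.2, integral_smul,
        intervalIntegral.integral_of_le hx.1.le]
    · refine setIntegral_congr_fun measurableSet_Ioc fun t ht => ?_
      rw [intervalIntegral.integral_of_le hab]
      have h1 : (fun x => Set.indicator {z : ℝ × ℝ | z.2 ≤ z.1} (fun z => p' z.1 • v z.2) (x, t))
          = Set.indicator (Set.Ici t) (fun x => p' x • v t) := by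
        ext t; simp [Set.indicator]
      simp only [h1]
      rw [integral_indicator measurableSet_Ici, Measure.restrict_restrict measurableSet_Ici]
      have h2 : Set.Ici t ∩ Set.Ioc a b = Set.Icc t b := by
        ext y; simp only [Set.mem_inter_iff, Set.mem_Ici, Set.mem_Ioc, Set.mem_Icc]
        exact ⟨fun h => ⟨h.1, h.2.2⟩, fun h => ⟨h.1, ht.1.trans_le h.1, h.2⟩⟩
      rw [h2, integral_smul_const, integral_Icc_eq_integral_Ioc,
        ← intervalIntegral.integral_of_le ht.2,
        intervalIntegral.integral_eq_sub_of_hasDerivAt (fun x _ => hp x)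
          (hp'.intervalIntegrable _ _)]
  · rw [Set.uIoc_of_le hab]
    have h1 : IntegrableOn p' (Set.Ioc a b) volume :=
      (hp'.locallyIntegrable.integrableOn_isCompact isCompact_Icc).mono_set Set.Ioc_subset_Icc_self
    have h2 : IntegrableOn v (Set.Ioc a b) volume :=
      (hv.integrableOn_isCompact isCompact_Icc).mono_set Set.Ioc_subset_Icc_self
    exact (Integrable.smul_prod h1 h2).indicator (measurableSet_le measurable_snd measurable_fst)

namespace IsPrimitive

variable {E : Type*} [NormedAddCommGroup E] [NormedSpace ℝ E]

theorem intervalIntegrable {u v : ℝ → E} (h : IsPrimitive u v) (a b : ℝ) :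
    IntervalIntegrable v volume a b :=
  h.1.intervalIntegrable' a b

theorem eq_add {u v : ℝ → E} (h : IsPrimitive u v) (a x : ℝ) : u x = u a + ∫ t in a..x, v t := by
  rw [← h.2 a x]; abel

theorem continuous {u v : ℝ → E} (h : IsPrimitive u v) : Continuous u := by
  have : u = fun x => u 0 + ∫ t in (0 : ℝ)..x, v t := funext fun x => h.eq_add 0 x
  rw [this]
  exact continuous_const.add (intervalIntegral.continuous_primitive (fun a b => h.intervalIntegrable a b) 0)

theorem of_hasDerivAt [CompleteSpace E] {u v : ℝ → E} (hu : ∀ x, HasDerivAt u (v x) x) (hv : Continuous v) :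
    IsPrimitive u v :=
  ⟨hv.locallyIntegrable, fun a b => (intervalIntegral.integral_eq_sub_of_hasDerivAt
    (fun x _ => hu x) (hv.intervalIntegrable a b)).symm⟩

theorem hasDerivAt [CompleteSpace E] {u v : ℝ → E} (h : IsPrimitive u v) (hv : Continuous v) (x : ℝ) :
    HasDerivAt u (v x) x := by
  have : u = fun x => u 0 + ∫ t in (0 : ℝ)..x, v t := funext fun x => h.eq_add 0 x
  rw [this]
  exact (intervalIntegral.integral_hasDerivAt_right (h.intervalIntegrable 0 x)
    hv.aestronglyMeasurable.stronglyMeasurableAtFilter hv.continuousAt).const_add _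

theorem congr {u v w : ℝ → E} (h : IsPrimitive u v) (hvw : v =ᵐ[volume] w) : IsPrimitive u w :=
  ⟨h.1.congr hvw, fun a b => (h.2 a b).trans
    (intervalIntegral.integral_congr_ae (hvw.mono fun _ hx _ => hx))⟩

theorem add {u v u₁ v₁ : ℝ → E} (h : IsPrimitive u v) (h₁ : IsPrimitive u₁ v₁) :
    IsPrimitive (fun x => u x + u₁ x) (fun x => v x + v₁ x) :=
  ⟨h.1.add h₁.1, fun a b => by
    rw [intervalIntegral.integral_add (h.intervalIntegrable a b) (h₁.intervalIntegrable a b),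
      ← h.2, ← h₁.2, add_sub_add_comm]⟩

theorem smul {𝕜 : Type*} [RCLike 𝕜] [NormedSpace 𝕜 E] [SMulCommClass ℝ 𝕜 E] [CompleteSpace E]
    {p p' : ℝ → 𝕜} {u v : ℝ → E} (hp : ∀ x, HasDerivAt p (p' x) x) (hp' : Continuous p')
    (h : IsPrimitive u v) :
    IsPrimitive (fun x => p x • u x) (fun x => p' x • u x + p x • v x) := by
  have hpc : Continuous p := continuous_iff_continuousAt.2 fun x => (hp x).continuousAt
  have hl : LocallyIntegrable (fun x => p' x • u x + p x • v x) volume := by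
    refine (hp'.smul h.continuous).locallyIntegrable.add ?_
    rw [← locallyIntegrableOn_univ] at *
    exact (locallyIntegrableOn_univ.2 h.1).continuousOn_smul isOpen_univ.isLocallyClosed hpc.continuousOn
  refine ⟨hl, ?_⟩
  have main : ∀ a b, a ≤ b → p b • u b - p a • u a = ∫ x in a..b, (p' x • u x + p x • v x) := by
    intro a b hab
    have e := intervalIntegral_smul_primitive hp hp' h.1 hab
    have hpv : IntervalIntegrable (fun x => p x • v x) volume a b :=
      (h.intervalIntegrable a b).continuousOn_smul hpc.continuousOn
    have hp'u : IntervalIntegrable (fun x => p' x • u x) volume a b :=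
      (hp'.smul h.continuous).intervalIntegrable _ _
    rw [intervalIntegral.integral_add hp'u hpv]
    have e1 : ∫ x in a..b, p' x • u x = (p b - p a) • u a + ∫ x in a..b, p' x • ∫ t in a..x, v t := by
      have : (fun x => p' x • u x) = fun x => p' x • u a + p' x • ∫ t in a..x, v t := by
        ext x; rw [← smul_add, ← h.eq_add a x]
      have i1 : IntervalIntegrable (fun x => p' x • u a) volume a b :=
        (hp'.smul continuous_const).intervalIntegrable _ _
      have i2 : IntervalIntegrable (fun x => p' x • ∫ t in a..x, v t) volume a b :=
        (hp'.smul (intervalIntegral.continuous_primitive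
          (fun a b => h.intervalIntegrable a b) a)).intervalIntegrable _ _
      rw [this, intervalIntegral.integral_add i1 i2,
        intervalIntegral.integral_smul_const,
        intervalIntegral.integral_eq_sub_of_hasDerivAt (fun x _ => hp x)
          (hp'.intervalIntegrable _ _)]
    have e2 : ∫ t in a..b, (p b - p t) • v t = p b • (u b - u a) - ∫ x in a..b, p x • v x := by
      simp only [sub_smul]
      have i1 : IntervalIntegrable (fun x => p b • v x) volume a b :=
        (h.intervalIntegrable a b).smul _
      rw [intervalIntegral.integral_sub i1 hpv,
        intervalIntegral.integral_smul, h.2]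
    rw [e1, e, e2]
    simp only [sub_smul, smul_sub]
    abel
  intro a b
  rcases le_total a b with hab | hab
  · exact main a b hab
  · rw [intervalIntegral.integral_symm, ← main b a hab]; abel

/-- The product rule for $\varphi u$ is integrated over an interval whose endpoints lie outside the
support of $\varphi$. -/
theorem hasWeakDeriv [CompleteSpace E] {u v : ℝ → E} (h : IsPrimitive u v) : HasWeakDeriv u v := by
  refine ⟨h.continuous.locallyIntegrable, h.1, fun φ hφ hc => ?_⟩
  have hd : ∀ x, HasDerivAt φ (deriv φ x) x := fun x =>
    (hφ.differentiable (by simp)).differentiableAt.hasDerivAt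
  have hd' : Continuous (deriv φ) := hφ.continuous_deriv (by simp)
  have hP := h.smul hd hd'
  obtain ⟨R, hR⟩ := hc.isCompact.isBounded.subset_closedBall 0
  have hz : ∀ x, R < |x| → φ x = 0 := fun x hx => by
    by_contra hne
    have := hR (subset_tsupport _ hne)
    simp at this; linarith
  have hz' : ∀ x, R < |x| → deriv φ x = 0 := fun x hx => by
    by_contra hne
    have := hR (tsupport_deriv_subset (subset_tsupport _ hne))
    simp at this; linarith
  set S := |R| + 1
  have hRS : R < S := by have := le_abs_self R; simp only [S]; linarith
  have hS : 0 < S := by positivity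
  have h0 : ∫ x in (-S)..S, (deriv φ x • u x + φ x • v x) = 0 := by
    rw [← hP.2]
    simp [hz S (by rwa [abs_of_pos hS]), hz (-S) (by rwa [abs_neg, abs_of_pos hS])]
  have hi : ∀ g : ℝ → E, (∀ x, R < |x| → g x = 0) → ∫ x in (-S)..S, g x = ∫ x, g x := fun g hg => by
    refine intervalIntegral.integral_eq_integral_of_support_subset fun x hx => ?_
    have : |x| ≤ R := not_lt.1 fun hlt => hx (hg x hlt)
    rw [abs_le] at this
    exact ⟨by linarith, by linarith⟩
  rw [← hi (fun x => deriv φ x • u x) (fun x hx => by simp [hz' x hx]),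
    ← hi (fun x => φ x • v x) (fun x hx => by simp [hz x hx]), eq_neg_iff_add_eq_zero,
    ← intervalIntegral.integral_add, h0]
  · exact (hd'.smul h.continuous).intervalIntegrable _ _
  · exact (h.intervalIntegrable _ _).continuousOn_smul hφ.continuous.continuousOn

end IsPrimitive

/-! ### Weak derivatives are indefinite integrals -/

/-- The antiderivative starting left of the support is constant to its right, and the zero mean
makes that constant zero. -/
theorem exists_contDiff_hasCompactSupport_deriv_eq {h : ℝ → ℝ} (hh : ContDiff ℝ ∞ h)
    (hc : HasCompactSupport h) (h0 : ∫ x, h x = 0) :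
    ∃ φ : ℝ → ℝ, ContDiff ℝ ∞ φ ∧ HasCompactSupport φ ∧ deriv φ = h := by
  obtain ⟨R, hR⟩ := hc.isCompact.isBounded.subset_closedBall 0
  set S := |R| + 1
  have hS : 0 < S := by positivity
  have hz : ∀ x, S ≤ |x| → h x = 0 := fun x hx => by
    by_contra hne
    have := hR (subset_tsupport _ hne)
    simp only [Metric.mem_closedBall, dist_zero_right, Real.norm_eq_abs] at this
    have := le_abs_self R
    simp only [S] at hx
    linarith
  have hd : ∀ x, HasDerivAt (fun x => ∫ t in (-S)..x, h t) (h x) x := fun x =>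
    intervalIntegral.integral_hasDerivAt_right (hh.continuous.intervalIntegrable _ _)
      hh.continuous.aestronglyMeasurable.stronglyMeasurableAtFilter hh.continuous.continuousAt
  have hde : deriv (fun x => ∫ t in (-S)..x, h t) = h := funext fun x => (hd x).deriv
  refine ⟨fun x => ∫ t in (-S)..x, h t, ?_, ?_, hde⟩
  · rw [contDiff_infty_iff_deriv, hde]
    exact ⟨fun x => (hd x).differentiableAt, hh⟩
  · refine HasCompactSupport.intro (isCompact_Icc (a := -S) (b := S)) fun x hx => ?_
    rw [Set.mem_Icc, not_and_or, not_le, not_le] at hx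
    rcases hx with hx | hx
    · rw [intervalIntegral.integral_congr (g := fun _ => (0 : ℝ)) fun t ht => hz t ?_]
      · simp
      · rw [Set.uIcc_of_ge hx.le] at ht
        rw [abs_of_nonpos (by linarith [ht.2])]; linarith [ht.2]
    · rw [intervalIntegral.integral_eq_integral_of_support_subset, h0]
      intro t ht
      have : |t| < S := not_le.1 fun hle => ht (hz t hle)
      rw [abs_lt] at this
      exact ⟨this.1, by linarith [this.2]⟩

section

variable {E : Type*} [NormedAddCommGroup E] [NormedSpace ℝ E]

theorem MeasureTheory.LocallyIntegrable.integrable_test_smul {w : ℝ → E}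
    (hw : LocallyIntegrable w volume) {g : ℝ → ℝ} (hg : Continuous g) (hc : HasCompactSupport g) :
    Integrable (fun x => g x • w x) volume :=
  hw.integrable_smul_left_of_hasCompactSupport hg hc

/-- The du Bois-Reymond lemma. For a bump $\rho$ of mass one, $g-(\int g)\rho$ is the derivative of
a test function, so $w$ pairs with every $g$ as the constant $\int\rho w$ does. -/
theorem ae_eq_const_of_integral_deriv_smul_eq_zero [CompleteSpace E] {w : ℝ → E} (hw : LocallyIntegrable w volume)
    (h : ∀ φ : ℝ → ℝ, ContDiff ℝ ∞ φ → HasCompactSupport φ → ∫ x, deriv φ x • w x = 0) :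
    ∃ c : E, ∀ᵐ x, w x = c := by
  let b : ContDiffBump (0 : ℝ) := ⟨1, 2, one_pos, one_lt_two⟩
  set ρ : ℝ → ℝ := b.normed volume
  have hρ : ContDiff ℝ ∞ ρ := b.contDiff_normed
  have hρc : HasCompactSupport ρ := b.hasCompactSupport_normed
  have hρ1 : ∫ x, ρ x = 1 := b.integral_normed
  refine ⟨∫ x, ρ x • w x, ae_eq_of_integral_contDiff_smul_eq hw
    continuous_const.locallyIntegrable fun g hg hgc => ?_⟩
  have hgi : Integrable g := hg.continuous.integrable_of_hasCompactSupport hgc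
  have hρi : Integrable ρ := hρ.continuous.integrable_of_hasCompactSupport hρc
  obtain ⟨φ, hφ, hφc, hφd⟩ := exists_contDiff_hasCompactSupport_deriv_eq
    (h := fun x => g x - (∫ t, g t) * ρ x) (hg.sub (contDiff_const.mul hρ))
    (hgc.sub hρc.mul_left) (by
      rw [integral_sub hgi (hρi.const_mul _), integral_const_mul, hρ1, mul_one, sub_self])
  have := h φ hφ hφc
  simp only [hφd, sub_smul, mul_smul] at this
  have i1 : Integrable (fun x => (∫ t, g t) • ρ x • w x) :=
    (hw.integrable_test_smul hρ.continuous hρc).smul _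
  rw [integral_sub (hw.integrable_test_smul hg.continuous hgc) i1, integral_smul,
    sub_eq_zero] at this
  rw [this, integral_smul_const]

namespace HasWeakDeriv

/-- The difference between $u$ and an indefinite integral of $v$ has zero weak derivative, hence is
almost everywhere constant. -/
theorem exists_isPrimitive [CompleteSpace E] {u v : ℝ → E} (h : HasWeakDeriv u v) :
    ∃ u₀, IsPrimitive u₀ v ∧ u =ᵐ[volume] u₀ := by
  have hP : IsPrimitive (fun x => ∫ t in (0 : ℝ)..x, v t) v :=
    ⟨h.2.1, fun a b => intervalIntegral.integral_interval_sub_left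
      (h.2.1.intervalIntegrable' _ _) (h.2.1.intervalIntegrable' _ _)⟩
  have hW := hP.hasWeakDeriv
  obtain ⟨c, hc⟩ := ae_eq_const_of_integral_deriv_smul_eq_zero (h.1.sub hW.1) fun φ hφ hφc => by
    have hφ' : Continuous (deriv φ) := hφ.continuous_deriv (by simp)
    simp only [Pi.sub_apply, smul_sub]
    rw [integral_sub (h.1.integrable_test_smul hφ' hφc.deriv)
      (hW.1.integrable_test_smul hφ' hφc.deriv), h.2.2 φ hφ hφc, hW.2.2 φ hφ hφc, sub_self]
  refine ⟨fun x => (∫ t in (0 : ℝ)..x, v t) + c, ⟨h.2.1, fun a b => ?_⟩, ?_⟩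
  · rw [← hP.2, add_sub_add_right_eq_sub]
  · filter_upwards [hc] with x hx
    rw [← hx]; simp

theorem ae_unique [CompleteSpace E] {u v w : ℝ → E} (h : HasWeakDeriv u v) (h' : HasWeakDeriv u w) :
    v =ᵐ[volume] w :=
  ae_eq_of_integral_contDiff_smul_eq h.2.1 h'.2.1 fun g hg hgc =>
    neg_injective ((h.2.2 g hg hgc).symm.trans (h'.2.2 g hg hgc))

theorem congr {u v u₁ v₁ : ℝ → E} (h : HasWeakDeriv u v) (hu : u =ᵐ[volume] u₁)
    (hv : v =ᵐ[volume] v₁) : HasWeakDeriv u₁ v₁ := by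
  refine ⟨h.1.congr hu, h.2.1.congr hv, fun φ hφ hc => ?_⟩
  rw [← integral_congr_ae (hu.mono fun x hx => by simp only [hx] :
      (fun x => deriv φ x • u x) =ᵐ[volume] fun x => deriv φ x • u₁ x),
    ← integral_congr_ae (hv.mono fun x hx => by simp only [hx] :
      (fun x => φ x • v x) =ᵐ[volume] fun x => φ x • v₁ x), h.2.2 φ hφ hc]

theorem weakDeriv {u v : ℝ → E} (h : HasWeakDeriv u v) : HasWeakDeriv u (weakDeriv u) := by
  have hex : ∃ v, HasWeakDeriv u v := ⟨v, h⟩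
  rw [_root_.weakDeriv, dif_pos hex]
  exact hex.choose_spec

/-- `weakDeriv` is an arbitrary choice within an almost-everywhere class; this lets any explicit
derivative stand in for it. -/
theorem weakDeriv_ae_eq [CompleteSpace E] {u v : ℝ → E} (h : HasWeakDeriv u v) : _root_.weakDeriv u =ᵐ[volume] v :=
  h.weakDeriv.ae_unique h

theorem weakDeriv_two_ae_eq [CompleteSpace E] {u v w : ℝ → E} (h : HasWeakDeriv u v) (h' : HasWeakDeriv v w) :
    _root_.weakDeriv^[2] u =ᵐ[volume] w :=
  (h'.congr h.weakDeriv_ae_eq.symm (ae_eq_refl _)).weakDeriv_ae_eq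

theorem hasWeakDerivsUpTo_two [CompleteSpace E] {u v w : ℝ → E} (h : HasWeakDeriv u v) (h' : HasWeakDeriv v w) :
    HasWeakDerivsUpTo 2 u := by
  intro j hj
  interval_cases j
  · exact h.weakDeriv
  · exact (h'.congr h.weakDeriv_ae_eq.symm (ae_eq_refl _)).weakDeriv

end HasWeakDeriv

theorem MemSobolevSpace.of_hasWeakDeriv [CompleteSpace E] {u v w : ℝ → E} (h : HasWeakDeriv u v)
    (h' : HasWeakDeriv v w) (hu : MemLp u 2 volume) (hv : MemLp v 2 volume)
    (hw : MemLp w 2 volume) : MemSobolevSpace 2 u := by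
  refine ⟨h.hasWeakDerivsUpTo_two h', fun j hj => ?_⟩
  interval_cases j
  · exact hu
  · exact (memLp_congr_ae h.weakDeriv_ae_eq).2 hv
  · exact (memLp_congr_ae (h.weakDeriv_two_ae_eq h')).2 hw

/-- An element of `H²` has a representative which is an iterated indefinite integral. -/
theorem MemSobolevSpace.exists_isPrimitive [CompleteSpace E] {u : ℝ → E} (h : MemSobolevSpace 2 u) :
    ∃ u₀ u₁, u =ᵐ[volume] u₀ ∧ IsPrimitive u₀ u₁ ∧ IsPrimitive u₁ (weakDeriv^[2] u) ∧
      MemLp u₀ 2 volume ∧ MemLp u₁ 2 volume := by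
  obtain ⟨u₁, h1, h1'⟩ := (h.1 1 (by norm_num)).exists_isPrimitive
  obtain ⟨u₀, h0, h0'⟩ := (h.1 0 (by norm_num)).exists_isPrimitive
  exact ⟨u₀, u₁, h0', h0.congr h1', h1, (memLp_congr_ae h0').1 (h.2 0 (by norm_num)),
    (memLp_congr_ae h1').1 (h.2 1 (by norm_num))⟩

/-- Solutions in `H²` of the Schrödinger equation, in terms of indefinite integrals. -/
theorem solvesSchrodinger_iff {V : ℝ → ℝ} {z : ℂ} {f u : ℝ → ℂ} :
    SolvesSchrodinger V z f u ↔ MemLp (fun x => (V x : ℂ) * u x - z * u x - f x) 2 volume ∧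
      ∃ u₀ u₁, u =ᵐ[volume] u₀ ∧ IsPrimitive u₀ u₁ ∧
      IsPrimitive u₁ (fun x => (V x : ℂ) * u₀ x - z * u₀ x - f x) ∧
      MemLp u₀ 2 volume ∧ MemLp u₁ 2 volume := by
  constructor
  · rintro ⟨hS, he⟩
    have he2 : weakDeriv^[2] u =ᵐ[volume] fun x => (V x : ℂ) * u x - z * u x - f x := by
      filter_upwards [he] with x hx
      rw [← hx]; ring
    obtain ⟨u₀, u₁, h0, h1, h2, m0, m1⟩ := hS.exists_isPrimitive
    refine ⟨(memLp_congr_ae he2).1 (hS.2 2 le_rfl), u₀, u₁, h0, h1, h2.congr ?_, m0, m1⟩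
    filter_upwards [he2, h0] with x hx hx0
    rw [hx, hx0]
  · rintro ⟨hm, u₀, u₁, h0, h1, h2, m0, m1⟩
    have e2 : (fun x => (V x : ℂ) * u₀ x - z * u₀ x - f x) =ᵐ[volume]
        fun x => (V x : ℂ) * u x - z * u x - f x := by
      filter_upwards [h0] with x hx
      rw [hx]
    have w1 := h1.hasWeakDeriv.congr h0.symm (ae_eq_refl _)
    have w2 := h2.hasWeakDeriv.congr (ae_eq_refl _) e2
    refine ⟨.of_hasWeakDeriv w1 w2 ((memLp_congr_ae h0).2 m0) m1 hm, ?_⟩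
    filter_upwards [w1.weakDeriv_two_ae_eq w2] with x hx
    rw [hx]; ring

end

/-! ### Linear second order equations: global existence and stability -/

/-- Integration reproduces the weight $e^{L|x|}$ with a gain of $1/L$, which makes the weighted
Picard map a contraction on the whole line. -/
theorem abs_integral_exp_mul_abs_le {L : ℝ} (hL : 0 < L) (x : ℝ) :
    |∫ t in (0 : ℝ)..x, Real.exp (L * |t|)| ≤ Real.exp (L * |x|) / L := by
  have main : ∀ y : ℝ, 0 ≤ y → ∫ t in (0 : ℝ)..y, Real.exp (L * |t|) =
      (Real.exp (L * |y|) - 1) / L := fun y hy => by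
    rw [intervalIntegral.integral_congr (g := fun t => Real.exp (L * t)) fun t ht => ?_,
      intervalIntegral.integral_comp_mul_left _ hL.ne', integral_exp, abs_of_nonneg hy]
    · simp [div_eq_inv_mul]
    · rw [Set.uIcc_of_le hy] at ht
      simp [abs_of_nonneg ht.1]
  have fin : ∀ y : ℝ, |(Real.exp (L * |y|) - 1) / L| ≤ Real.exp (L * |y|) / L := fun y => by
    have h1 : 1 ≤ Real.exp (L * |y|) := Real.one_le_exp (by positivity)
    rw [abs_of_nonneg (div_nonneg (by linarith) hL.le)]
    gcongr; linarith
  rcases le_total 0 x with hx | hx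
  · rw [main x hx]; exact fin x
  · have := intervalIntegral.integral_comp_neg (a := 0) (b := x) fun t => Real.exp (L * |t|)
    simp only [abs_neg, neg_zero] at this
    rw [this, intervalIntegral.integral_symm, main (-x) (by linarith), abs_neg, abs_neg]
    exact fin x

/-- Global existence for the linear first order system `y' = y₁`, `y₁' = q y`. -/
theorem exists_integral_eq_linear {q : ℝ → ℂ} (hq : Continuous q) {Q : ℝ} (hQ : ∀ x, ‖q x‖ ≤ Q)
    (c : ℂ × ℂ) : ∃ Y : ℝ → ℂ × ℂ, Continuous Y ∧
      ∀ x, Y x = c + ∫ t in (0 : ℝ)..x, ((Y t).2, q t * (Y t).1) := by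
  set K : ℝ := max 1 Q
  have hK : 0 < K := lt_max_of_lt_left one_pos
  -- $K$ bounds the linear map $G(t,\cdot)$ in the sup norm, so the rate $2K$ gives contraction
  -- factor $K/L=\tfrac12$.
  set L : ℝ := 2 * K with hLdef
  have hL : 0 < L := by positivity
  let G : ℝ → ℂ × ℂ → ℂ × ℂ := fun t z => (z.2, q t * z.1)
  have hG : ∀ t z, ‖G t z‖ ≤ K * ‖z‖ := fun t z => by
    refine max_le ?_ ?_
    · calc ‖z.2‖ ≤ 1 * ‖z‖ := by rw [one_mul]; exact norm_snd_le z
        _ ≤ K * ‖z‖ := by gcongr; exact le_max_left _ _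
    · simp only [G, norm_mul]
      gcongr
      · exact (hQ t).trans (le_max_right _ _)
      · exact norm_fst_le z
  have hGsub : ∀ t z w, G t z - G t w = G t (z - w) := fun t z w => by
    ext <;> simp [G, mul_sub]
  have hsmul : ∀ (t r : ℝ) z, G t (r • z) = r • G t z := fun t r z => by
    ext <;> simp [G, mul_left_comm]
  have hE : Continuous fun t : ℝ => Real.exp (L * |t|) := by fun_prop
  have hGc : ∀ Z : BoundedContinuousFunction ℝ (ℂ × ℂ), Continuous fun t => G t (Z t) := fun Z => by
    have := Z.continuous
    fun_prop
  have hInt : ∀ (B : ℝ → ℂ × ℂ) (M : ℝ), Continuous B → (∀ t, ‖B t‖ ≤ M) → ∀ x,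
      ‖Real.exp (-(L * |x|)) • ∫ t in (0 : ℝ)..x, Real.exp (L * |t|) • B t‖ ≤ M / L := by
    intro B M hB hM x
    have hM0 : 0 ≤ M := (norm_nonneg _).trans (hM 0)
    have h1 : ‖∫ t in (0 : ℝ)..x, Real.exp (L * |t|) • B t‖ ≤
        |∫ t in (0 : ℝ)..x, Real.exp (L * |t|) * M| := by
      refine intervalIntegral.norm_integral_le_abs_of_norm_le (ae_of_all _ fun t => ?_)
        ((hE.mul continuous_const).intervalIntegrable _ _)
      rw [norm_smul, Real.norm_eq_abs, abs_of_pos (Real.exp_pos _)]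
      gcongr
      exact hM t
    rw [intervalIntegral.integral_mul_const, abs_mul, abs_of_nonneg hM0] at h1
    rw [norm_smul, Real.norm_eq_abs, abs_of_pos (Real.exp_pos _)]
    calc _ ≤ Real.exp (-(L * |x|)) * (Real.exp (L * |x|) / L * M) := by
          gcongr
          exact h1.trans (by gcongr; exact abs_integral_exp_mul_abs_le hL x)
      _ = M / L := by
          rw [Real.exp_neg]; field_simp
  have hcont : ∀ B : ℝ → ℂ × ℂ, Continuous B → Continuous fun x : ℝ =>
      Real.exp (-(L * |x|)) • (c + ∫ t in (0 : ℝ)..x, Real.exp (L * |t|) • B t) := fun B hB => by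
    have := intervalIntegral.continuous_primitive (μ := volume)
      (fun a b => (hE.smul hB).intervalIntegrable a b) 0
    fun_prop
  -- The Picard map written for $Z=e^{-L|x|}Y$. In this weighted unknown solutions are bounded, so a
  -- single fixed point is global and no local solutions need gluing.
  let T : BoundedContinuousFunction ℝ (ℂ × ℂ) → BoundedContinuousFunction ℝ (ℂ × ℂ) := fun Z =>
    BoundedContinuousFunction.ofNormedAddCommGroup
      (fun x : ℝ => Real.exp (-(L * |x|)) • (c + ∫ t in (0 : ℝ)..x, Real.exp (L * |t|) • G t (Z t)))
      (hcont _ (hGc Z)) (‖c‖ + K * ‖Z‖ / L) (fun x => by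
        rw [smul_add]
        refine norm_add_le_of_le ?_ (hInt _ _ (hGc Z) (fun t => (hG t _).trans ?_) x)
        · rw [norm_smul, Real.norm_eq_abs, abs_of_pos (Real.exp_pos _)]
          refine mul_le_of_le_one_left (norm_nonneg _) (Real.exp_le_one_iff.2 ?_)
          have : 0 ≤ L * |x| := by positivity
          linarith
        · gcongr
          exact Z.norm_coe_le_norm t)
  have hT : ∀ Z x, T Z x = Real.exp (-(L * |x|)) •
      (c + ∫ t in (0 : ℝ)..x, Real.exp (L * |t|) • G t (Z t)) := fun _ _ => rfl
  have hcontr : ContractingWith (1 / 2) T := by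
    refine ⟨by norm_num, LipschitzWith.of_dist_le_mul fun Z W => ?_⟩
    refine (BoundedContinuousFunction.dist_le (by positivity)).2 fun x => ?_
    have hi : ∀ Z : BoundedContinuousFunction ℝ (ℂ × ℂ),
        IntervalIntegrable (fun t => Real.exp (L * |t|) • G t (Z t)) volume 0 x := fun Z =>
      (hE.smul (hGc Z)).intervalIntegrable _ _
    rw [dist_eq_norm, hT, hT, ← smul_sub, add_sub_add_left_eq_sub,
      ← intervalIntegral.integral_sub (hi Z) (hi W)]
    simp only [← smul_sub, hGsub]
    refine (hInt (fun t => G t (Z t - W t)) (K * dist Z W) (hGc (Z - W))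
      (fun t => (hG t _).trans ?_) x).trans (le_of_eq ?_)
    · gcongr
      rw [← dist_eq_norm]
      exact BoundedContinuousFunction.dist_coe_le_dist t
    · rw [hLdef]; push_cast; field_simp
  obtain ⟨Z, hZ, -⟩ := hcontr.exists_fixedPoint 0 (edist_ne_top _ _)
  have hY : ∀ x, Real.exp (L * |x|) • Z x =
      c + ∫ t in (0 : ℝ)..x, Real.exp (L * |t|) • G t (Z t) := fun x => by
    have : Z x = T Z x := by rw [hZ.eq]
    rw [this, hT, smul_smul, ← Real.exp_add, add_neg_cancel, Real.exp_zero, one_smul]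
  refine ⟨fun x => Real.exp (L * |x|) • Z x, hE.smul Z.continuous, fun x => (hY x).trans ?_⟩
  simp only [← hsmul]
  rfl

/-- `y` is a solution of `y'' = q y` with derivative `y₁`. -/
structure IsODESol (q : ℝ → ℂ) (y y₁ : ℝ → ℂ) : Prop where
  deriv : ∀ x, HasDerivAt y (y₁ x) x
  deriv_snd : ∀ x, HasDerivAt y₁ (q x * y x) x

namespace IsODESol

theorem continuous {q y y₁ : ℝ → ℂ} (h : IsODESol q y y₁) : Continuous y :=
  continuous_iff_continuousAt.2 fun x => (h.deriv x).continuousAt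

theorem continuous_snd {q y y₁ : ℝ → ℂ} (h : IsODESol q y y₁) : Continuous y₁ :=
  continuous_iff_continuousAt.2 fun x => (h.deriv_snd x).continuousAt

theorem comp_neg {q y y₁ : ℝ → ℂ} (h : IsODESol q y y₁) :
    IsODESol (fun x => q (-x)) (fun x => y (-x)) (fun x => -y₁ (-x)) :=
  ⟨fun x => by
      simpa [Function.comp_def] using (h.deriv (-x)).scomp x (hasDerivAt_neg x),
    fun x => by
      simpa [Function.comp_def] using ((h.deriv_snd (-x)).scomp x (hasDerivAt_neg x)).fun_neg⟩

theorem comp_add {q y y₁ : ℝ → ℂ} (h : IsODESol q y y₁) (a : ℝ) :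
    IsODESol (fun x => q (x + a)) (fun x => y (x + a)) (fun x => y₁ (x + a)) :=
  ⟨fun x => (h.deriv _).comp_add_const x a, fun x => (h.deriv_snd _).comp_add_const x a⟩

end IsODESol

theorem exists_isODESol {q : ℝ → ℂ} (hq : Continuous q) {Q : ℝ} (hQ : ∀ x, ‖q x‖ ≤ Q)
    (a : ℝ) (c : ℂ × ℂ) : ∃ y y₁, IsODESol q y y₁ ∧ y a = c.1 ∧ y₁ a = c.2 := by
  have hq' : Continuous fun x => q (x + a) := by fun_prop
  obtain ⟨Y, hY, hYe⟩ := exists_integral_eq_linear hq' (fun x => hQ (x + a)) c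
  have hc : Continuous fun t => ((Y t).2, q (t + a) * (Y t).1) := by fun_prop
  have hd : ∀ x, HasDerivAt Y ((Y x).2, q (x + a) * (Y x).1) x := fun x => by
    have := (intervalIntegral.integral_hasDerivAt_right (hc.intervalIntegrable 0 x)
      hc.aestronglyMeasurable.stronglyMeasurableAtFilter hc.continuousAt).const_add c
    exact this.congr_of_eventuallyEq (Eventually.of_forall hYe)
  have hS : IsODESol (fun x => q (x + a)) (fun x => (Y x).1) (fun x => (Y x).2) :=
    ⟨fun x => (hd x).fst, fun x => (hd x).snd⟩
  refine ⟨_, _, by simpa using hS.comp_add (-a), ?_, ?_⟩ <;> simp [hYe 0]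

/-- Stability of solutions: Grönwall's inequality for the difference of two solutions. -/
theorem norm_le_of_perturbed_ode {d d₁ q g : ℝ → ℂ} {a b K ε : ℝ} (hK : 1 ≤ K)
    (hd : ∀ x ∈ Set.Icc a b, HasDerivAt d (d₁ x) x)
    (hd₁ : ∀ x ∈ Set.Icc a b, HasDerivAt d₁ (q x * d x + g x) x)
    (hq : ∀ x ∈ Set.Icc a b, ‖q x‖ ≤ K) (hg : ∀ x ∈ Set.Icc a b, ‖g x‖ ≤ ε) (hε : 0 ≤ ε)
    {δ : ℝ} (h0 : ‖d a‖ ≤ δ) (h1 : ‖d₁ a‖ ≤ δ) :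
    ∀ x ∈ Set.Icc a b, ‖d x‖ ≤ (δ + ε) * Real.exp (K * (x - a)) ∧
      ‖d₁ x‖ ≤ (δ + ε) * Real.exp (K * (x - a)) := by
  intro x hx
  have hD : ∀ x ∈ Set.Icc a b,
      HasDerivAt (fun x => (d x, d₁ x)) (d₁ x, q x * d x + g x) x := fun x hx =>
    (hd x hx).prodMk (hd₁ x hx)
  have key := norm_le_gronwallBound_of_norm_deriv_right_le (a := a) (b := b) (K := K) (ε := ε)
    (δ := δ) (f := fun x => (d x, d₁ x)) (f' := fun x => (d₁ x, q x * d x + g x))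
    (fun x hx => (hD x hx).continuousAt.continuousWithinAt)
    (fun x hx => (hD x (Set.Ico_subset_Icc_self hx)).hasDerivWithinAt)
    (max_le h0 h1) (fun x hx => by
      have hx := Set.Ico_subset_Icc_self hx
      have n1 : ‖d x‖ ≤ ‖(d x, d₁ x)‖ := norm_fst_le (d x, d₁ x)
      have n2 : ‖d₁ x‖ ≤ ‖(d x, d₁ x)‖ := norm_snd_le (d x, d₁ x)
      refine max_le ?_ ?_
      · nlinarith [norm_nonneg (d x, d₁ x)]
      · refine norm_add_le_of_le ?_ (hg x hx)
        rw [norm_mul]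
        exact mul_le_mul (hq x hx) n1 (norm_nonneg _) (by linarith)) x hx
  -- Since $K\ge1$, the quotient $\varepsilon/K$ in the Grönwall bound is at most $\varepsilon$.
  have hb : gronwallBound δ K ε (x - a) ≤ (δ + ε) * Real.exp (K * (x - a)) := by
    rw [gronwallBound_of_K_ne_0 (by linarith)]
    have e1 : 1 ≤ Real.exp (K * (x - a)) :=
      Real.one_le_exp (mul_nonneg (by linarith) (by linarith [hx.1]))
    have : ε / K * (Real.exp (K * (x - a)) - 1) ≤ ε * Real.exp (K * (x - a)) := by
      have : ε / K ≤ ε := div_le_self hε hK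
      have : 0 ≤ ε / K := by positivity
      nlinarith
    linarith
  exact ⟨(norm_fst_le (d x, d₁ x)).trans (key.trans hb), (norm_snd_le (d x, d₁ x)).trans (key.trans hb)⟩

/-! ### Jost solutions and their dependence on potential and frequency -/

/-- `V` is a continuous potential supported in `[-A, A]`. -/
structure IsPotential (A : ℝ) (V : ℝ → ℝ) : Prop where
  pos : 0 < A
  cont : Continuous V
  zero : ∀ x, A ≤ |x| → V x = 0

theorem IsPotential.comp_neg {A : ℝ} {V : ℝ → ℝ} (h : IsPotential A V) :
    IsPotential A (fun x => V (-x)) :=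
  ⟨h.pos, h.cont.comp continuous_neg, fun x hx => h.zero _ (by rwa [abs_neg])⟩

theorem IsPotential.exists_bound {A : ℝ} {V : ℝ → ℝ} (h : IsPotential A V) :
    ∃ M, 0 ≤ M ∧ ∀ x, |V x| ≤ M := by
  obtain ⟨M, hM⟩ := isCompact_Icc.exists_bound_of_continuousOn (s := Set.Icc (-A) A)
    h.cont.continuousOn
  refine ⟨max M 0, le_max_right _ _, fun x => ?_⟩
  by_cases hx : A ≤ |x|
  · simp [h.zero x hx]
  · exact (hM x (abs_le.1 (not_le.1 hx).le)).trans (le_max_left _ _)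

theorem hasDerivAt_exp_mul_ofReal (c : ℂ) (x : ℝ) :
    HasDerivAt (fun x : ℝ => Complex.exp (c * x)) (c * Complex.exp (c * x)) x := by
  have h1 : HasDerivAt (fun x : ℝ => c * (x : ℂ)) (c * 1) x :=
    (Complex.ofRealCLM.hasDerivAt (x := x)).const_mul c
  simpa [mul_comm] using h1.cexp

theorem norm_exp_mul_ofReal (c : ℂ) (x : ℝ) :
    ‖Complex.exp (c * x)‖ = Real.exp (c.re * x) := by
  rw [Complex.norm_exp]; simp

/-- The Jost solution at `-∞`: it equals `e^{-iκx}` to the left of the support of `V`. -/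
structure IsJost (A : ℝ) (V : ℝ → ℝ) (κ : ℂ) (m m₁ : ℝ → ℂ) : Prop where
  sol : IsODESol (fun x => (V x : ℂ) - κ ^ 2) m m₁
  left : ∀ x : ℝ, x ≤ -A → m x = Complex.exp (-(Complex.I * κ) * x)
  left_snd : ∀ x : ℝ, x ≤ -A → m₁ x = -(Complex.I * κ) * Complex.exp (-(Complex.I * κ) * x)

/-- To the right of the support of `V`, solutions are combinations of exponentials. -/
theorem IsODESol.eq_of_free_right {A : ℝ} {V : ℝ → ℝ} (hV : IsPotential A V) {κ : ℂ}
    {y y₁ : ℝ → ℂ} (h : IsODESol (fun x => (V x : ℂ) - κ ^ 2) y y₁) (α β : ℂ)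
    (h0 : y A = α * Complex.exp (Complex.I * κ * A) + β * Complex.exp (-(Complex.I * κ) * A))
    (h1 : y₁ A = α * (Complex.I * κ * Complex.exp (Complex.I * κ * A)) +
      β * (-(Complex.I * κ) * Complex.exp (-(Complex.I * κ) * A))) (x : ℝ) (hx : A ≤ x) :
    y x = α * Complex.exp (Complex.I * κ * x) + β * Complex.exp (-(Complex.I * κ) * x) ∧
    y₁ x = α * (Complex.I * κ * Complex.exp (Complex.I * κ * x)) +
      β * (-(Complex.I * κ) * Complex.exp (-(Complex.I * κ) * x)) := by
  have e1 := fun x => hasDerivAt_exp_mul_ofReal (Complex.I * κ) x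
  have e2 := fun x => hasDerivAt_exp_mul_ofReal (-(Complex.I * κ)) x
  -- Uniqueness as the case of zero data and zero forcing in the stability estimate.
  have key := norm_le_of_perturbed_ode (a := A) (b := x) (K := max 1 (‖κ ^ 2‖)) (ε := 0) (δ := 0)
    (d := fun x => y x - (α * Complex.exp (Complex.I * κ * x) +
      β * Complex.exp (-(Complex.I * κ) * x)))
    (d₁ := fun x => y₁ x - (α * (Complex.I * κ * Complex.exp (Complex.I * κ * x)) +
      β * (-(Complex.I * κ) * Complex.exp (-(Complex.I * κ) * x))))
    (q := fun _ => -κ ^ 2) (g := fun _ => 0) (le_max_left _ _)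
    (fun x _ => (h.deriv x).sub (((e1 x).const_mul α).add ((e2 x).const_mul β)))
    (fun x hx => by
      convert! (h.deriv_snd x).sub ((((e1 x).const_mul (Complex.I * κ)).const_mul α).add
        (((e2 x).const_mul (-(Complex.I * κ))).const_mul β)) using 1
      rw [hV.zero x (hx.1.trans (le_abs_self x))]
      push_cast
      linear_combination (κ ^ 2 * α * Complex.exp (Complex.I * κ * x) +
        κ ^ 2 * β * Complex.exp (-(Complex.I * κ) * x)) * Complex.I_sq)
    (fun x _ => by rw [norm_neg]; exact le_max_right _ _) (fun x _ => by simp) le_rfl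
    (by rw [h0]; simp) (by rw [h1]; simp) x ⟨hx, le_rfl⟩
  simp only [add_zero, zero_mul, norm_le_zero_iff, sub_eq_zero] at key
  exact key

theorem exists_isJost {A : ℝ} {V : ℝ → ℝ} (hV : IsPotential A V) (κ : ℂ) :
    ∃ m m₁, IsJost A V κ m m₁ := by
  obtain ⟨M, hM0, hM⟩ := hV.exists_bound
  have hc := hV.cont
  obtain ⟨y, y₁, hy, h0, h1⟩ := exists_isODESol (q := fun x => (V x : ℂ) - κ ^ 2) (by fun_prop)
    (Q := M + ‖κ ^ 2‖) (fun x => norm_sub_le_of_le (by simpa using hM x) le_rfl) (-A)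
    (Complex.exp (Complex.I * κ * A), -(Complex.I * κ) * Complex.exp (Complex.I * κ * A))
  simp only at h0 h1
  -- Reflection turns the free region on the left into the free region on the right.
  have hr : ∀ x : ℝ, x ≤ -A → y x = Complex.exp (-(Complex.I * κ) * x) ∧
      y₁ x = -(Complex.I * κ) * Complex.exp (-(Complex.I * κ) * x) := fun x hx => by
    have := hy.comp_neg.eq_of_free_right hV.comp_neg 1 0 (by rw [h0]; simp) (by rw [h1]; simp)
      (-x) (by linarith)
    simp only [neg_neg] at this
    refine ⟨by rw [this.1]; simp, ?_⟩
    rw [← neg_neg (y₁ x), this.2]; simp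
  exact ⟨y, y₁, hy, fun x hx => (hr x hx).1, fun x hx => (hr x hx).2⟩

open Classical in
/-- The Jost solution at `-∞` together with its derivative. -/
noncomputable def jostPair (A : ℝ) (V : ℝ → ℝ) (κ : ℂ) : (ℝ → ℂ) × (ℝ → ℂ) :=
  if h : ∃ Y : (ℝ → ℂ) × (ℝ → ℂ), IsJost A V κ Y.1 Y.2 then h.choose else 0

/-- The Jost solution at `-∞`. -/
noncomputable def jostLeft (A : ℝ) (V : ℝ → ℝ) (κ : ℂ) : ℝ → ℂ := (jostPair A V κ).1

/-- The derivative of the Jost solution at `-∞`. -/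
noncomputable def jostLeftDeriv (A : ℝ) (V : ℝ → ℝ) (κ : ℂ) : ℝ → ℂ := (jostPair A V κ).2

/-- The Jost solution at `+∞`. -/
noncomputable def jostRight (A : ℝ) (V : ℝ → ℝ) (κ : ℂ) (x : ℝ) : ℂ :=
  jostLeft A (fun x => V (-x)) κ (-x)

/-- The derivative of the Jost solution at `+∞`. -/
noncomputable def jostRightDeriv (A : ℝ) (V : ℝ → ℝ) (κ : ℂ) (x : ℝ) : ℂ :=
  -jostLeftDeriv A (fun x => V (-x)) κ (-x)

section

variable {A : ℝ} {V : ℝ → ℝ}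

theorem isJost_jostLeft (hV : IsPotential A V) (κ : ℂ) :
    IsJost A V κ (jostLeft A V κ) (jostLeftDeriv A V κ) := by
  have h : ∃ Y : (ℝ → ℂ) × (ℝ → ℂ), IsJost A V κ Y.1 Y.2 := by
    obtain ⟨m, m₁, h⟩ := exists_isJost hV κ
    exact ⟨(m, m₁), h⟩
  rw [jostLeft, jostLeftDeriv, jostPair, dif_pos h]
  exact h.choose_spec

theorem isODESol_jostRight (hV : IsPotential A V) (κ : ℂ) :
    IsODESol (fun x => (V x : ℂ) - κ ^ 2) (jostRight A V κ) (jostRightDeriv A V κ) := by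
  have := (isJost_jostLeft hV.comp_neg κ).sol.comp_neg
  simp only [neg_neg] at this
  exact this

theorem jostRight_eq (hV : IsPotential A V) (κ : ℂ) {x : ℝ} (hx : A ≤ x) :
    jostRight A V κ x = Complex.exp (Complex.I * κ * x) := by
  rw [jostRight, (isJost_jostLeft hV.comp_neg κ).left _ (by linarith)]; simp

theorem jostRightDeriv_eq (hV : IsPotential A V) (κ : ℂ) {x : ℝ} (hx : A ≤ x) :
    jostRightDeriv A V κ x = Complex.I * κ * Complex.exp (Complex.I * κ * x) := by
  rw [jostRightDeriv, (isJost_jostLeft hV.comp_neg κ).left_snd _ (by linarith)]; simp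

theorem IsODESol.wronskian_eq {q y y₁ z z₁ : ℝ → ℂ} (hy : IsODESol q y y₁) (hz : IsODESol q z z₁)
    (a b : ℝ) : y a * z₁ a - y₁ a * z a = y b * z₁ b - y₁ b * z b := by
  refine is_const_of_deriv_eq_zero (f := fun x => y x * z₁ x - y₁ x * z x) ?_ ?_ a b
  · exact fun x => (((hy.deriv x).mul (hz.deriv_snd x)).sub
      ((hy.deriv_snd x).mul (hz.deriv x))).differentiableAt
  · intro x
    refine HasDerivAt.deriv ?_
    convert! ((hy.deriv x).mul (hz.deriv_snd x)).sub ((hy.deriv_snd x).mul (hz.deriv x)) using 1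
    ring

/-- The Wronskian of the two Jost solutions. -/
noncomputable def jostWronskian (A : ℝ) (V : ℝ → ℝ) (κ : ℂ) : ℂ :=
  jostRight A V κ 0 * jostLeftDeriv A V κ 0 - jostRightDeriv A V κ 0 * jostLeft A V κ 0

theorem jostWronskian_eq (hV : IsPotential A V) (κ : ℂ) (x : ℝ) :
    jostRight A V κ x * jostLeftDeriv A V κ x - jostRightDeriv A V κ x * jostLeft A V κ x =
      jostWronskian A V κ :=
  (isODESol_jostRight hV κ).wronskian_eq (isJost_jostLeft hV κ).sol x 0

/-- At $x=A$ the right Jost solution is explicit, so only the value and slope of the left one at $A$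
remain. Both the continuity and the lower bounds of the Wronskian use this form. -/
theorem jostWronskian_eq_exp_mul (hV : IsPotential A V) (κ : ℂ) :
    jostWronskian A V κ = Complex.exp (Complex.I * κ * A) *
      (jostLeftDeriv A V κ A - Complex.I * κ * jostLeft A V κ A) := by
  rw [← jostWronskian_eq hV κ A, jostRight_eq hV κ le_rfl, jostRightDeriv_eq hV κ le_rfl]
  ring

theorem norm_exp_neg_I_mul (κ : ℂ) (x : ℝ) :
    ‖Complex.exp (-(Complex.I * κ) * x)‖ = Real.exp (κ.im * x) := by
  rw [norm_exp_mul_ofReal]; simp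

theorem norm_exp_I_mul (κ : ℂ) (x : ℝ) :
    ‖Complex.exp (Complex.I * κ * x)‖ = Real.exp (-(κ.im * x)) := by
  rw [norm_exp_mul_ofReal]; simp

/-- Joint continuity of the Jost solution in the potential and the frequency. -/
theorem jostLeft_continuity (hV : IsPotential A V) (l : ℂ) (r : ℝ) {η : ℝ} (hη : 0 < η) :
    ∃ δ > 0, ∀ U, IsPotential A U → (∀ x, |U x - V x| ≤ δ) → ∀ κ : ℂ, ‖κ - l‖ ≤ δ →
      ∀ x ∈ Set.Icc (-A) r, ‖jostLeft A U κ x - jostLeft A V l x‖ ≤ η ∧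
        ‖jostLeftDeriv A U κ x - jostLeftDeriv A V l x‖ ≤ η := by
  obtain ⟨M, hM0, hM⟩ := hV.exists_bound
  have hJ := isJost_jostLeft hV l
  obtain ⟨B, hB⟩ := isCompact_Icc.exists_bound_of_continuousOn (s := Set.Icc (-A) r)
    hJ.sol.continuous.continuousOn
  set K : ℝ := max 1 (M + 1 + (‖l‖ + 1) ^ 2) with hK
  have hK1 : 1 ≤ K := le_max_left _ _
  let e : ℂ → ℂ := fun κ => Complex.exp (-(Complex.I * κ) * (-A : ℝ))
  -- The Grönwall bound on the difference of the two Jost solutions: mismatch of the data at $-A$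
  -- plus the forcing $((U-V)-(\kappa^2-l^2))\,m_V$. It is continuous and vanishes at $(0,l)$, which
  -- supplies $\delta$.
  let F : ℝ × ℂ → ℝ := fun z => (‖e z.2 - e l‖ +
    ‖-(Complex.I * z.2) * e z.2 - -(Complex.I * l) * e l‖ + (z.1 + ‖z.2 ^ 2 - l ^ 2‖) * |B|) *
      Real.exp (K * (r + A))
  have hF : Continuous F := by fun_prop
  have hF0 : F (0, l) = 0 := by simp [F]
  have hF1 : ∀ᶠ z in 𝓝 ((0 : ℝ), l), F z < η :=
    hF.continuousAt.eventually_lt continuousAt_const (by rw [hF0]; exact hη)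
  obtain ⟨δ, hδ, hb⟩ := Metric.eventually_nhds_iff.1 hF1
  refine ⟨min 1 (δ / 2), by positivity, fun U hU hUV κ hκ x hx => ?_⟩
  set ρ := min 1 (δ / 2)
  have hρ : 0 < ρ := by positivity
  have hρδ : ρ < δ := (min_le_right _ _).trans_lt (by linarith)
  have hρ1 : ρ ≤ 1 := min_le_left _ _
  have hFlt : F (ρ, κ) < η := hb (by
    rw [Prod.dist_eq, max_lt_iff]
    refine ⟨?_, ?_⟩
    · simpa [abs_of_pos hρ] using hρδ
    · rw [dist_eq_norm]; exact hκ.trans_lt hρδ)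
  have hJU := isJost_jostLeft hU κ
  have hκn : ‖κ‖ ≤ ‖l‖ + 1 := by
    have := norm_add_le (κ - l) l
    rw [sub_add_cancel] at this
    linarith
  have key := norm_le_of_perturbed_ode (a := -A) (b := r) (K := K)
    (δ := ‖e κ - e l‖ + ‖-(Complex.I * κ) * e κ - -(Complex.I * l) * e l‖)
    (ε := (ρ + ‖κ ^ 2 - l ^ 2‖) * |B|)
    (d := fun x => jostLeft A U κ x - jostLeft A V l x)
    (d₁ := fun x => jostLeftDeriv A U κ x - jostLeftDeriv A V l x)
    (q := fun x => (U x : ℂ) - κ ^ 2)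
    (g := fun x => (((U x - V x : ℝ) : ℂ) - (κ ^ 2 - l ^ 2)) * jostLeft A V l x) hK1
    (fun x _ => (hJU.sol.deriv x).sub (hJ.sol.deriv x))
    (fun x _ => by
      convert! (hJU.sol.deriv_snd x).sub (hJ.sol.deriv_snd x) using 1
      push_cast; ring)
    (fun x _ => by
      refine le_trans ?_ (le_max_right _ _)
      refine norm_sub_le_of_le ?_ ?_
      · have h1 := hUV x
        have h2 := hM x
        rw [Complex.norm_real, Real.norm_eq_abs]
        have := abs_add_le (U x - V x) (V x)
        rw [sub_add_cancel] at this
        linarith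
      · rw [norm_pow]; gcongr)
    (fun x hx => by
      rw [norm_mul]
      gcongr
      · refine norm_sub_le_of_le ?_ le_rfl
        rw [Complex.norm_real]; exact hUV x
      · exact (hB x hx).trans (le_abs_self B))
    (by positivity)
    (by rw [hJU.left _ le_rfl, hJ.left _ le_rfl]; exact le_add_of_nonneg_right (norm_nonneg _))
    (by rw [hJU.left_snd _ le_rfl, hJ.left_snd _ le_rfl]
        exact le_add_of_nonneg_left (norm_nonneg _)) x hx
  have hfin : (‖e κ - e l‖ + ‖-(Complex.I * κ) * e κ - -(Complex.I * l) * e l‖ +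
      (ρ + ‖κ ^ 2 - l ^ 2‖) * |B|) * Real.exp (K * (x - -A)) ≤ F (ρ, κ) := by
    simp only [F]
    gcongr
    linarith [hx.2]
  exact ⟨key.1.trans (hfin.trans hFlt.le), key.2.trans (hfin.trans hFlt.le)⟩

end

/-! ### Real frequencies: uniform bounds and the lower bound for the Wronskian -/

theorem IsODESol.isPrimitive {q y y₁ : ℝ → ℂ} (h : IsODESol q y y₁) : IsPrimitive y y₁ :=
  .of_hasDerivAt h.deriv h.continuous_snd

theorem IsODESol.isPrimitive_snd {q y y₁ : ℝ → ℂ} (h : IsODESol q y y₁) (hq : Continuous q) :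
    IsPrimitive y₁ (fun x => q x * y x) :=
  .of_hasDerivAt h.deriv_snd (hq.mul h.continuous)

theorem IsODESol.conj {q y y₁ : ℝ → ℂ} (h : IsODESol q y y₁) :
    IsODESol (fun x => star (q x)) (fun x => star (y x)) (fun x => star (y₁ x)) :=
  ⟨fun x => (h.deriv x).star, fun x => by simpa using (h.deriv_snd x).star⟩

/-- Energy estimate for real frequencies, uniform in the frequency. -/
theorem IsODESol.energy_le {U : ℝ → ℝ} {k M : ℝ} {y y₁ : ℝ → ℂ} (hM : ∀ x, |U x| ≤ M)
    (h : IsODESol (fun x => (U x : ℂ) - (k : ℂ) ^ 2) y y₁) {a x : ℝ} (hx : a ≤ x) :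
    (1 + k ^ 2) * ‖y x‖ ^ 2 + ‖y₁ x‖ ^ 2 ≤
      ((1 + k ^ 2) * ‖y a‖ ^ 2 + ‖y₁ a‖ ^ 2) * Real.exp ((1 + M) * (x - a)) := by
  set e : ℝ → ℝ := fun x => (1 + k ^ 2) * ‖y x‖ ^ 2 + ‖y₁ x‖ ^ 2
  have hM0 : 0 ≤ M := (abs_nonneg _).trans (hM 0)
  have he0 : ∀ x, 0 ≤ e x := fun x => by positivity
  -- With the weight $1+k^2$ the $k^2$ terms cancel in the derivative, so the growth rate does not
  -- depend on $k$; the summand $1$ keeps control of $y$ at $k=0$.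
  have hd : ∀ x, HasDerivAt e (2 * (1 + U x) * inner ℝ (y x) (y₁ x)) x := fun x => by
    convert! ((h.deriv x).norm_sq.const_mul (1 + k ^ 2)).add (h.deriv_snd x).norm_sq using 1
    have : ((U x : ℂ) - (k : ℂ) ^ 2) * y x = (U x - k ^ 2 : ℝ) • y x := by
      rw [Complex.real_smul]; push_cast; ring
    rw [this, inner_smul_right, real_inner_comm (y x)]
    ring
  have key := norm_le_gronwallBound_of_norm_deriv_right_le (a := a) (b := x) (K := 1 + M) (ε := 0)
    (f := e) (fun x _ => (hd x).continuousAt.continuousWithinAt)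
    (fun x _ => (hd x).hasDerivWithinAt) le_rfl (fun x _ => by
      rw [add_zero, Real.norm_eq_abs, Real.norm_eq_abs, abs_of_nonneg (he0 x), abs_mul, abs_mul,
        abs_two]
      have h1 := abs_real_inner_le_norm (y x) (y₁ x)
      have h2 : |1 + U x| ≤ 1 + M := (abs_add_le _ _).trans (by rw [abs_one]; gcongr; exact hM x)
      have h3 : 2 * |inner ℝ (y x) (y₁ x)| ≤ e x := by
        simp only [e]
        nlinarith [sq_nonneg (‖y x‖ - ‖y₁ x‖), mul_nonneg (sq_nonneg k) (sq_nonneg ‖y x‖)]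
      calc 2 * |1 + U x| * |inner ℝ (y x) (y₁ x)|
          = |1 + U x| * (2 * |inner ℝ (y x) (y₁ x)|) := by ring
        _ ≤ (1 + M) * e x := mul_le_mul h2 h3 (by positivity) (by positivity)) x ⟨hx, le_rfl⟩
  rw [gronwallBound_ε0, Real.norm_eq_abs, Real.norm_eq_abs, abs_of_nonneg (he0 x),
    abs_of_nonneg (he0 a)] at key
  exact key

/-- The bound for Jost solutions with real frequency. -/
noncomputable def jostBound (A M : ℝ) : ℝ := 2 * Real.exp ((1 + M) * A)

theorem jostBound_pos (A M : ℝ) : 0 < jostBound A M := by unfold jostBound; positivity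

section

variable {A : ℝ} {V : ℝ → ℝ}

/-- The energy at $-A$ is $1+2k^2\le4(1+k^2)$, and it grows over a length of at most $2A$; the
square root of the result is `jostBound` times $\sqrt{1+k^2}$. -/
theorem norm_jostLeft_le (hV : IsPotential A V) {M : ℝ} (hM : ∀ x, |V x| ≤ M) (k : ℝ) {x : ℝ}
    (hx : x ≤ A) : ‖jostLeft A V k x‖ ≤ jostBound A M ∧
      ‖jostLeftDeriv A V k x‖ ≤ jostBound A M * (1 + |k|) := by
  have hJ := isJost_jostLeft hV k
  have hM0 : 0 ≤ M := (abs_nonneg _).trans (hM 0)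
  have hA := hV.pos
  have n1 : ∀ x : ℝ, x ≤ -A → ‖jostLeft A V k x‖ = 1 := fun x hx => by
    rw [hJ.left x hx, norm_exp_neg_I_mul]; simp
  have n2 : ∀ x : ℝ, x ≤ -A → ‖jostLeftDeriv A V k x‖ = |k| := fun x hx => by
    rw [hJ.left_snd x hx, norm_mul, norm_exp_neg_I_mul]; simp
  have hB1 : 1 ≤ jostBound A M := by
    have : 1 ≤ Real.exp ((1 + M) * A) := Real.one_le_exp (by positivity)
    unfold jostBound; linarith
  rcases le_total x (-A) with hx' | hx'
  · rw [n1 x hx', n2 x hx']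
    refine ⟨hB1, ?_⟩
    have := abs_nonneg k
    nlinarith
  · have key := hJ.sol.energy_le hM hx'
    rw [n1 _ le_rfl, n2 _ le_rfl, sq_abs] at key
    have hexp : Real.exp ((1 + M) * (x - -A)) ≤ Real.exp ((1 + M) * A) ^ 2 := by
      rw [← Real.exp_nat_mul]
      apply Real.exp_le_exp.2
      push_cast
      nlinarith
    have key2 : (1 + k ^ 2) * ‖jostLeft A V k x‖ ^ 2 + ‖jostLeftDeriv A V k x‖ ^ 2 ≤
        (1 + k ^ 2) * jostBound A M ^ 2 := by
      refine key.trans ?_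
      unfold jostBound
      nlinarith [sq_nonneg k, sq_nonneg (Real.exp ((1 + M) * A)), Real.exp_pos ((1 + M) * (x - -A)),
        mul_nonneg (sq_nonneg k) (sq_nonneg (Real.exp ((1 + M) * A)))]
    have hB := jostBound_pos A M
    constructor
    · refine le_of_sq_le_sq ?_ hB.le
      have : 0 < 1 + k ^ 2 := by positivity
      refine le_of_mul_le_mul_left ?_ this
      nlinarith [sq_nonneg ‖jostLeftDeriv A V k x‖]
    · refine le_of_sq_le_sq ?_ (by positivity)
      rw [mul_pow]
      have : 1 + k ^ 2 ≤ (1 + |k|) ^ 2 := by nlinarith [abs_nonneg k, sq_abs k]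
      nlinarith [mul_nonneg (by positivity : 0 ≤ 1 + k ^ 2) (sq_nonneg ‖jostLeft A V k x‖),
        sq_nonneg (jostBound A M)]

theorem norm_jostRight_le (hV : IsPotential A V) {M : ℝ} (hM : ∀ x, |V x| ≤ M) (k : ℝ) {x : ℝ}
    (hx : -A ≤ x) : ‖jostRight A V k x‖ ≤ jostBound A M ∧
      ‖jostRightDeriv A V k x‖ ≤ jostBound A M * (1 + |k|) := by
  rw [jostRight, jostRightDeriv, norm_neg]
  exact norm_jostLeft_le hV.comp_neg (fun x => hM (-x)) k (by linarith)

theorem norm_jostWronskian_real (hV : IsPotential A V) (k : ℝ) :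
    ‖jostWronskian A V k‖ = ‖jostLeftDeriv A V k A - Complex.I * k * jostLeft A V k A‖ := by
  rw [jostWronskian_eq_exp_mul hV, norm_mul, norm_exp_I_mul]; simp

/-- For real $V$ and $k$, $\bar m$ solves the same equation as $m$, and their Wronskian is the
constant $-2ik$ found at $-A$. Evaluated at $A$ it yields $|m'-ikm|^2=|m'+ikm|^2+4k^2$.
Equivalently, for $k\ne0$, the transmission coefficient has modulus at most one. -/
theorem two_mul_abs_le_norm_jostWronskian (hV : IsPotential A V) (k : ℝ) :
    2 * |k| ≤ ‖jostWronskian A V k‖ := by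
  have hJ := isJost_jostLeft hV k
  have hc : IsODESol (fun x => (V x : ℂ) - (k : ℂ) ^ 2) (fun x => star (jostLeft A V k x))
      (fun x => star (jostLeftDeriv A V k x)) := by
    simpa using! hJ.sol.conj
  have h := hc.wronskian_eq hJ.sol A (-A)
  rw [hJ.left _ le_rfl, hJ.left_snd _ le_rfl] at h
  have hE : star (Complex.exp (-(Complex.I * (k : ℂ)) * ((-A : ℝ) : ℂ))) *
      Complex.exp (-(Complex.I * (k : ℂ)) * ((-A : ℝ) : ℂ)) = 1 := by
    have := Complex.conj_mul' (Complex.exp (-(Complex.I * (k : ℂ)) * ((-A : ℝ) : ℂ)))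
    rw [norm_exp_neg_I_mul] at this
    simpa using! this
  have h' : star (jostLeft A V k A) * jostLeftDeriv A V k A -
      star (jostLeftDeriv A V k A) * jostLeft A V k A = -(2 * Complex.I * k) := by
    rw [h, star_mul']
    have : star (-(Complex.I * (k : ℂ))) = Complex.I * k := by simp
    rw [this]
    linear_combination (-(2 * Complex.I * k)) * hE
  rw [norm_jostWronskian_real hV]
  set m := jostLeft A V k A
  set m₁ := jostLeftDeriv A V k A
  have him : m.re * m₁.im - m.im * m₁.re = -k := by
    have := congrArg Complex.im h'
    simp at this
    linarith
  refine le_of_sq_le_sq ?_ (norm_nonneg _)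
  rw [← Complex.normSq_eq_norm_sq, Complex.normSq_apply, mul_pow, sq_abs]
  simp
  have hk : k * (m.re * m₁.im - m.im * m₁.re) = -k ^ 2 := by rw [him]; ring
  nlinarith [sq_nonneg (m₁.re - k * m.im), sq_nonneg (m₁.im + k * m.re)]

/-- For $|k|\ge\tau$ the universal bound $2|k|$ suffices, whatever the potential. For $|k|\le\tau$
the Wronskian stays within half of $|W_V(0)|$ by joint continuity at zero frequency. -/
theorem exists_norm_jostWronskian_ge (hV : IsPotential A V) (h0 : jostWronskian A V 0 ≠ 0) :
    ∃ ρ > 0, ∃ c > 0, ∀ U, IsPotential A U → (∀ x, |U x - V x| ≤ ρ) → ∀ k : ℝ,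
      c * (1 + |k|) ≤ ‖jostWronskian A U k‖ := by
  have e0 := norm_jostWronskian_real hV 0
  simp only [Complex.ofReal_zero, mul_zero, zero_mul, sub_zero] at e0
  set w := ‖jostWronskian A V 0‖
  have hw : 0 < w := norm_pos_iff.2 h0
  set B := ‖jostLeft A V 0 A‖
  have hB : 0 ≤ B := norm_nonneg _
  obtain ⟨δ, hδ, hb⟩ := jostLeft_continuity hV 0 A (η := w / 4) (by positivity)
  -- The second entry makes the term $ik\,m_U(A)$ cost at most $w/4$, because $|m_U(A)|\le B+w/4$.
  set τ := min δ (w / (4 * (B + w)))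
  have hτ : 0 < τ := by positivity
  have hτδ : τ ≤ δ := min_le_left _ _
  have hτw : τ * (B + w) ≤ w / 4 := by
    calc τ * (B + w) ≤ w / (4 * (B + w)) * (B + w) := by gcongr; exact min_le_right _ _
      _ = w / 4 := by field_simp
  -- The two entries turn the bounds $w/2$ for $|k|\le\tau$ and $2|k|$ for $|k|\ge\tau$ into
  -- multiples of $1+|k|$.
  refine ⟨δ, hδ, min (w / (2 * (1 + τ))) (2 * τ / (1 + τ)), by positivity, fun U hU hUV k => ?_⟩
  rcases le_total |k| τ with hk | hk
  · have hA := hV.pos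
    obtain ⟨h1, h2⟩ := hb U hU hUV (k : ℂ) (by simpa using hk.trans hτδ) A ⟨by linarith, le_rfl⟩
    have h3 : w / 2 ≤ ‖jostWronskian A U k‖ := by
      rw [norm_jostWronskian_real hU]
      have t1 := norm_sub_norm_le (jostLeftDeriv A V 0 A) (jostLeftDeriv A V 0 A -
        (jostLeftDeriv A U k A - Complex.I * k * jostLeft A U k A))
      rw [sub_sub_cancel] at t1
      have t2 : ‖jostLeftDeriv A V 0 A - (jostLeftDeriv A U k A - Complex.I * k * jostLeft A U k A)‖
          ≤ w / 4 + τ * (B + w) := by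
        rw [← sub_add]
        refine norm_add_le_of_le (by rw [norm_sub_rev]; exact h2) ?_
        rw [norm_mul, norm_mul, Complex.norm_I, one_mul, Complex.norm_real, Real.norm_eq_abs]
        gcongr
        have := norm_le_norm_add_norm_sub' (jostLeft A U k A) (jostLeft A V 0 A)
        linarith
      linarith
    calc _ ≤ w / (2 * (1 + τ)) * (1 + τ) := by gcongr; exact min_le_left _ _
      _ = w / 2 := by field_simp
      _ ≤ _ := h3
  · refine le_trans ?_ (two_mul_abs_le_norm_jostWronskian hU k)
    calc _ ≤ 2 * τ / (1 + τ) * (1 + |k|) := by gcongr; exact min_le_right _ _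
      _ ≤ 2 * |k| := by
        rw [div_mul_eq_mul_div, div_le_iff₀ (by positivity)]
        nlinarith

/-- At zero frequency the vanishing Wronskian says $m'(A)=0$. Then $m$ is constant on both sides of
the support, hence a nontrivial bounded solution. -/
theorem isExceptional_of_jostWronskian_eq_zero (hV : IsPotential A V)
    (h0 : jostWronskian A V 0 = 0) : IsExceptional V := by
  have hJ := isJost_jostLeft hV 0
  have hc := hV.cont
  have h1 : jostLeftDeriv A V 0 A = 0 := by
    rw [jostWronskian_eq_exp_mul hV] at h0
    simpa using h0
  have hr : ∀ x, A ≤ x → jostLeft A V 0 x = jostLeft A V 0 A := fun x hx => by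
    have := (hJ.sol.eq_of_free_right hV (jostLeft A V 0 A) 0 (by simp) (by simp [h1]) x hx).1
    simpa using this
  have hl : ∀ x, x ≤ -A → jostLeft A V 0 x = 1 := fun x hx => by rw [hJ.left x hx]; simp
  obtain ⟨B, hB⟩ := isCompact_Icc.exists_bound_of_continuousOn (s := Set.Icc (-A) A)
    hJ.sol.continuous.continuousOn
  have hA := hV.pos
  refine ⟨jostLeft A V 0, jostLeftDeriv A V 0, ?_, ?_, hJ.sol.isPrimitive.hasWeakDeriv, ?_⟩
  · refine memLp_top_of_bound hJ.sol.continuous.aestronglyMeasurable B (ae_of_all _ fun x => ?_)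
    rcases le_total x (-A) with hx | hx
    · rw [hl x hx, ← hl (-A) le_rfl]; exact hB _ ⟨le_rfl, by linarith⟩
    · rcases le_total x A with hx' | hx'
      · exact hB x ⟨hx, hx'⟩
      · rw [hr x hx']; exact hB _ ⟨by linarith, le_rfl⟩
  · intro hz
    have := (Continuous.ae_eq_iff_eq volume hJ.sol.continuous continuous_zero).1 hz
    have := congrFun this (-A)
    rw [hl _ le_rfl] at this
    simp at this
  · have := (hJ.sol.isPrimitive_snd (by fun_prop)).hasWeakDeriv
    simpa using this

end

/-! ### Convolution with a decaying exponential on $L^2$ -/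

theorem integrable_exp_neg_mul_abs {ε : ℝ} (hε : 0 < ε) :
    Integrable (fun x : ℝ => Real.exp (-(ε * |x|))) := by
  rw [← integrableOn_univ, ← Set.Iic_union_Ioi (a := (0 : ℝ)), integrableOn_union]
  constructor
  · refine (integrableOn_exp_mul_Iic hε 0).congr_fun (fun x hx => ?_) measurableSet_Iic
    simp only [abs_of_nonpos (Set.mem_Iic.1 hx)]; ring_nf
  · refine (integrableOn_exp_mul_Ioi (neg_lt_zero.2 hε) 0).congr_fun (fun x hx => ?_) measurableSet_Ioi
    simp only [abs_of_pos (Set.mem_Ioi.1 hx)]; ring_nf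

/-- The kernel `e^{-ε|x-y|}`. -/
noncomputable def expKernel (ε x y : ℝ) : ENNReal := ENNReal.ofReal (Real.exp (-(ε * |x - y|)))

theorem measurable_expKernel (ε : ℝ) : Measurable (Function.uncurry (expKernel ε)) := by
  unfold expKernel Function.uncurry
  fun_prop

theorem expKernel_half_mul_self (ε x y : ℝ) :
    expKernel (ε / 2) x y * expKernel (ε / 2) x y = expKernel ε x y := by
  unfold expKernel
  rw [← ENNReal.ofReal_mul (Real.exp_pos _).le, ← Real.exp_add]
  ring_nf

theorem expKernel_comm (ε x y : ℝ) : expKernel ε x y = expKernel ε y x := by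
  unfold expKernel; rw [abs_sub_comm]

theorem expKernel_le_one {ε : ℝ} (hε : 0 ≤ ε) (x y : ℝ) : expKernel ε x y ≤ 1 := by
  unfold expKernel
  rw [ENNReal.ofReal_le_one, Real.exp_le_one_iff]
  have : 0 ≤ ε * |x - y| := by positivity
  linarith

theorem lintegral_expKernel (ε x : ℝ) : ∫⁻ y, expKernel ε x y = ∫⁻ y, expKernel ε 0 y := by
  simp only [expKernel_comm ε x, expKernel_comm ε 0]
  unfold expKernel
  rw [lintegral_sub_right_eq_self (fun y : ℝ => ENNReal.ofReal (Real.exp (-(ε * |y|)))) x]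
  simp

theorem lintegral_expKernel_lt_top {ε : ℝ} (hε : 0 < ε) : ∫⁻ y, expKernel ε 0 y < ⊤ := by
  have := (integrable_exp_neg_mul_abs hε).lintegral_lt_top
  simpa [expKernel] using this

/-- The convolution of `g` with `e^{-ε|x|}`. -/
noncomputable def expConv (ε : ℝ) (g : ℝ → ENNReal) (x : ℝ) : ENNReal :=
  ∫⁻ y, expKernel ε x y * g y

/-- Cauchy–Schwarz after writing the kernel as the square of the kernel with half the rate.
Integrating in $x$ then gives Young's inequality. -/
theorem expConv_sq_le (ε : ℝ) {g : ℝ → ENNReal} (hg : AEMeasurable g) (x : ℝ) :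
    expConv ε g x ^ 2 ≤ (∫⁻ y, expKernel ε 0 y) * ∫⁻ y, expKernel ε x y * g y ^ 2 := by
  have hm : Measurable (expKernel (ε / 2) x) :=
    (measurable_expKernel (ε / 2)).comp measurable_prodMk_left
  have h := ENNReal.lintegral_mul_le_Lp_mul_Lq volume Real.HolderConjugate.two_two
    hm.aemeasurable (hm.aemeasurable.mul hg)
  simp only [Pi.mul_apply, ← mul_assoc, expKernel_half_mul_self] at h
  have e1 : ∀ y, expKernel (ε / 2) x y ^ (2 : ℝ) = expKernel ε x y := fun y => by
    rw [ENNReal.rpow_two, sq, expKernel_half_mul_self]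
  have e2 : ∀ y, (expKernel (ε / 2) x y * g y) ^ (2 : ℝ) = expKernel ε x y * g y ^ 2 := fun y => by
    rw [ENNReal.rpow_two, mul_pow, sq (expKernel _ _ _), expKernel_half_mul_self]
  simp only [e1, e2, lintegral_expKernel ε x] at h
  have hs : ∀ a : ENNReal, (a ^ (1 / 2 : ℝ)) ^ 2 = a := fun a => by
    rw [← ENNReal.rpow_two, ← ENNReal.rpow_mul]; norm_num
  calc expConv ε g x ^ 2 ≤ _ := pow_le_pow_left₀ zero_le h 2
    _ = _ := by rw [mul_pow, hs, hs]

theorem expConv_lt_top {ε : ℝ} (hε : 0 < ε) {g : ℝ → ENNReal} (hg : AEMeasurable g)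
    (hg2 : ∫⁻ y, g y ^ 2 < ⊤) (x : ℝ) : expConv ε g x < ⊤ := by
  have h : expConv ε g x ^ 2 < ⊤ := (expConv_sq_le ε hg x).trans_lt <|
    ENNReal.mul_lt_top (lintegral_expKernel_lt_top hε) <| lt_of_le_of_lt
      (lintegral_mono fun y => mul_le_of_le_one_left zero_le (expKernel_le_one hε.le x y)) hg2
  by_contra hne
  rw [not_lt, top_le_iff] at hne
  simp [hne] at h

theorem lintegral_expConv_sq_lt_top {ε : ℝ} (hε : 0 < ε) {g : ℝ → ENNReal} (hg : AEMeasurable g)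
    (hg2 : ∫⁻ y, g y ^ 2 < ⊤) : ∫⁻ x, expConv ε g x ^ 2 < ⊤ := by
  have hK := lintegral_expKernel_lt_top hε
  refine (lintegral_mono fun x => expConv_sq_le ε hg x).trans_lt ?_
  rw [lintegral_const_mul' _ _ hK.ne, lintegral_lintegral_swap]
  · refine ENNReal.mul_lt_top hK ?_
    have : ∀ y, ∫⁻ x, expKernel ε x y * g y ^ 2 = (∫⁻ y, expKernel ε 0 y) * g y ^ 2 := fun y => by
      rw [lintegral_mul_const]
      · simp only [expKernel_comm ε _ y, lintegral_expKernel ε y]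
      · exact (measurable_expKernel ε).comp measurable_prodMk_right
    simp only [this]
    rw [lintegral_const_mul' _ _ hK.ne]
    exact ENNReal.mul_lt_top hK hg2
  · exact (measurable_expKernel ε).aemeasurable.mul ((hg.comp_snd).pow_const 2)

/-! ### The Green function and the resolvent in the upper half plane -/

section

variable {A : ℝ} {V : ℝ → ℝ}

/-- Right of the support $m$ is a combination of $e^{\pm i\kappa x}$, and for $x\ge A>0$ both are at
most $e^{\operatorname{Im}\kappa\,x}$ in modulus. Left of it the bound is explicit, and in between
it is compactness. -/
theorem exists_norm_jostLeft_le_exp (hV : IsPotential A V) {κ : ℂ} (hκ : 0 < κ.im) :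
    ∃ C, 0 ≤ C ∧ ∀ x, ‖jostLeft A V κ x‖ ≤ C * Real.exp (κ.im * x) ∧
      ‖jostLeftDeriv A V κ x‖ ≤ C * Real.exp (κ.im * x) := by
  have hJ := isJost_jostLeft hV κ
  have hA := hV.pos
  have hκ0 : κ ≠ 0 := fun h => by simp [h] at hκ
  obtain ⟨B, hB⟩ := isCompact_Icc.exists_bound_of_continuousOn (s := Set.Icc (-A) A)
    (f := fun x => Real.exp (-(κ.im * x)) • jostLeft A V κ x)
    (by have := hJ.sol.continuous; fun_prop)
  obtain ⟨B', hB'⟩ := isCompact_Icc.exists_bound_of_continuousOn (s := Set.Icc (-A) A)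
    (f := fun x => Real.exp (-(κ.im * x)) • jostLeftDeriv A V κ x)
    (by have := hJ.sol.continuous_snd; fun_prop)
  set m := jostLeft A V κ
  set m₁ := jostLeftDeriv A V κ
  have hexp : Complex.exp (-(Complex.I * κ * A)) * Complex.exp (Complex.I * κ * A) = 1 := by
    rw [← Complex.exp_add]; simp
  obtain ⟨α, β, hr⟩ : ∃ α β : ℂ, ∀ x : ℝ, A ≤ x →
      m x = α * Complex.exp (Complex.I * κ * x) + β * Complex.exp (-(Complex.I * κ) * x) ∧
      m₁ x = α * (Complex.I * κ * Complex.exp (Complex.I * κ * x)) +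
        β * (-(Complex.I * κ) * Complex.exp (-(Complex.I * κ) * x)) := by
    -- The coefficients solve the two-by-two system given by value and slope at $A$, which is
    -- invertible because $\kappa\ne0$.
    refine ⟨_, _, hJ.sol.eq_of_free_right hV
      ((m A / 2 + m₁ A / (2 * (Complex.I * κ))) * Complex.exp (-(Complex.I * κ) * A))
      ((m A / 2 - m₁ A / (2 * (Complex.I * κ))) * Complex.exp (Complex.I * κ * A)) ?_ ?_⟩
    · rw [neg_mul]
      linear_combination (-(m A)) * hexp
    · have hI := Complex.I_ne_zero
      field_simp
      linear_combination (-2 * (m₁ A)) * hexp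
  have key : ∀ x, (‖m x‖ ≤ (‖α‖ + ‖β‖) * Real.exp (κ.im * x) ∨ ‖m x‖ ≤ |B| * Real.exp (κ.im * x) ∨
      ‖m x‖ ≤ 1 * Real.exp (κ.im * x)) ∧ (‖m₁ x‖ ≤ (‖α‖ + ‖β‖) * ‖κ‖ * Real.exp (κ.im * x) ∨
      ‖m₁ x‖ ≤ |B'| * Real.exp (κ.im * x) ∨ ‖m₁ x‖ ≤ ‖κ‖ * Real.exp (κ.im * x)) := by
    intro x
    rcases le_total x (-A) with hx | hx
    · refine ⟨.inr (.inr ?_), .inr (.inr ?_)⟩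
      · rw [hJ.left x hx, norm_exp_neg_I_mul, one_mul]
      · rw [hJ.left_snd x hx, norm_mul, norm_exp_neg_I_mul]; simp
    · rcases le_total x A with hx' | hx'
      · refine ⟨.inr (.inl ?_), .inr (.inl ?_)⟩
        · have := (hB x ⟨hx, hx'⟩).trans (le_abs_self B)
          rw [norm_smul, Real.norm_eq_abs, abs_of_pos (Real.exp_pos _), Real.exp_neg,
            inv_mul_le_iff₀ (Real.exp_pos _)] at this
          linarith
        · have := (hB' x ⟨hx, hx'⟩).trans (le_abs_self B')
          rw [norm_smul, Real.norm_eq_abs, abs_of_pos (Real.exp_pos _), Real.exp_neg,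
            inv_mul_le_iff₀ (Real.exp_pos _)] at this
          linarith
      · have h1 : ‖Complex.exp (Complex.I * κ * x)‖ ≤ Real.exp (κ.im * x) := by
          rw [norm_exp_I_mul]
          apply Real.exp_le_exp.2
          have : 0 ≤ κ.im * x := mul_nonneg hκ.le (by linarith)
          linarith
        have h2 : ‖Complex.exp (-(Complex.I * κ) * x)‖ ≤ Real.exp (κ.im * x) := by
          rw [norm_exp_neg_I_mul]
        refine ⟨.inl ?_, .inl ?_⟩
        · rw [(hr x hx').1, add_mul]
          refine norm_add_le_of_le ?_ ?_ <;> rw [norm_mul] <;> gcongr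
        · rw [(hr x hx').2, add_mul, add_mul]
          refine norm_add_le_of_le ?_ ?_
          · rw [norm_mul, norm_mul, norm_mul Complex.I, Complex.norm_I, one_mul, mul_assoc ‖α‖]; gcongr
          · rw [norm_mul, norm_mul, norm_neg, norm_mul Complex.I, Complex.norm_I, one_mul, mul_assoc ‖β‖]
            gcongr
  refine ⟨(‖α‖ + ‖β‖) * (1 + ‖κ‖) + |B| + |B'| + 1 + ‖κ‖, by positivity, fun x => ⟨?_, ?_⟩⟩
  · have p1 := mul_nonneg (add_nonneg (norm_nonneg α) (norm_nonneg β)) (norm_nonneg κ)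
    rcases (key x).1 with h | h | h <;>
      refine h.trans (mul_le_mul_of_nonneg_right ?_ (Real.exp_pos _).le) <;>
      linarith [norm_nonneg α, norm_nonneg β, norm_nonneg κ, abs_nonneg B, abs_nonneg B']
  · have p1 := mul_nonneg (add_nonneg (norm_nonneg α) (norm_nonneg β)) (norm_nonneg κ)
    rcases (key x).2 with h | h | h <;>
      refine h.trans (mul_le_mul_of_nonneg_right ?_ (Real.exp_pos _).le) <;>
      linarith [norm_nonneg α, norm_nonneg β, norm_nonneg κ, abs_nonneg B, abs_nonneg B']

theorem exists_norm_jostRight_le_exp (hV : IsPotential A V) {κ : ℂ} (hκ : 0 < κ.im) :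
    ∃ C, 0 ≤ C ∧ ∀ x, ‖jostRight A V κ x‖ ≤ C * Real.exp (-(κ.im * x)) ∧
      ‖jostRightDeriv A V κ x‖ ≤ C * Real.exp (-(κ.im * x)) := by
  obtain ⟨C, hC, h⟩ := exists_norm_jostLeft_le_exp hV.comp_neg hκ
  refine ⟨C, hC, fun x => ?_⟩
  have := h (-x)
  rwa [mul_neg, ← norm_neg (jostLeftDeriv _ _ _ _)] at this

end

/-- The Green function of `H_V - κ²` applied to `f`. -/
noncomputable def green (A : ℝ) (V : ℝ → ℝ) (κ : ℂ) (f : ℝ → ℂ) (x : ℝ) : ℂ :=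
  (jostWronskian A V κ)⁻¹ * (jostRight A V κ x * (∫ y in Set.Iic x, jostLeft A V κ y * f y) +
    jostLeft A V κ x * ∫ y in Set.Ioi x, jostRight A V κ y * f y)

/-- The derivative of `green`. -/
noncomputable def greenDeriv (A : ℝ) (V : ℝ → ℝ) (κ : ℂ) (f : ℝ → ℂ) (x : ℝ) : ℂ :=
  (jostWronskian A V κ)⁻¹ * (jostRightDeriv A V κ x * (∫ y in Set.Iic x, jostLeft A V κ y * f y) +
    jostLeftDeriv A V κ x * ∫ y in Set.Ioi x, jostRight A V κ y * f y)

/-- The integrals in the definition of `green` converge. -/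
def GreenIntegrable (A : ℝ) (V : ℝ → ℝ) (κ : ℂ) (f : ℝ → ℂ) : Prop :=
  ∀ x, IntegrableOn (fun y => jostLeft A V κ y * f y) (Set.Iic x) ∧
    IntegrableOn (fun y => jostRight A V κ y * f y) (Set.Ioi x)

theorem isPrimitive_integral_Iic {g : ℝ → ℂ} (hg : ∀ x, IntegrableOn g (Set.Iic x)) :
    IsPrimitive (fun x => ∫ y in Set.Iic x, g y) g :=
  ⟨fun x => ⟨Set.Iic (x + 1), Iic_mem_nhds (by linarith), hg _⟩,
    fun a b => intervalIntegral.integral_Iic_sub_Iic (hg a) (hg b)⟩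

theorem isPrimitive_integral_Ioi {g : ℝ → ℂ} (hg : ∀ x, IntegrableOn g (Set.Ioi x)) :
    IsPrimitive (fun x => ∫ y in Set.Ioi x, g y) (fun x => -g x) :=
  ⟨LocallyIntegrable.neg fun x => ⟨Set.Ioi (x - 1), Ioi_mem_nhds (by linarith), hg _⟩,
    fun a b => by
      rw [intervalIntegral.integral_neg, ← intervalIntegral.integral_Ioi_sub_Ioi' (hg a) (hg b)]
      ring⟩

section

variable {A : ℝ} {V : ℝ → ℝ} {κ : ℂ} {f : ℝ → ℂ}

/-- Differentiating the two integrals produces $\pm p\,m f$, and these terms cancel. -/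
theorem isPrimitive_green (hV : IsPotential A V) (hf : GreenIntegrable A V κ f) :
    IsPrimitive (green A V κ f) (greenDeriv A V κ f) := by
  have hL := isPrimitive_integral_Iic fun x => (hf x).1
  have hR := isPrimitive_integral_Ioi fun x => (hf x).2
  have hm := (isJost_jostLeft hV κ).sol
  have hp := isODESol_jostRight hV κ
  have h := (IsPrimitive.smul (p := fun _ => (jostWronskian A V κ)⁻¹) (fun x => hasDerivAt_const x _)
    continuous_const ((IsPrimitive.smul hp.deriv hp.continuous_snd hL).add
      (IsPrimitive.smul hm.deriv hm.continuous_snd hR)))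
  refine (congrArg (IsPrimitive _) (funext fun x => ?_)).mpr h
  simp only [greenDeriv, smul_eq_mul]
  ring

/-- The endpoint terms now combine to $(p'm-m'p)f/W=-f$, which is the source of the equation. -/
theorem isPrimitive_greenDeriv (hV : IsPotential A V) (hf : GreenIntegrable A V κ f)
    (hW : jostWronskian A V κ ≠ 0) : IsPrimitive (greenDeriv A V κ f)
      (fun x => (V x : ℂ) * green A V κ f x - κ ^ 2 * green A V κ f x - f x) := by
  have hL := isPrimitive_integral_Iic fun x => (hf x).1
  have hR := isPrimitive_integral_Ioi fun x => (hf x).2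
  have hm := (isJost_jostLeft hV κ).sol
  have hp := isODESol_jostRight hV κ
  have hVc := hV.cont
  have hcm := hm.continuous
  have hcp := hp.continuous
  have h := (IsPrimitive.smul (p := fun _ => (jostWronskian A V κ)⁻¹) (fun x => hasDerivAt_const x _)
    continuous_const ((IsPrimitive.smul hp.deriv_snd (by fun_prop) hL).add
      (IsPrimitive.smul hm.deriv_snd (by fun_prop) hR)))
  refine (congrArg (IsPrimitive _) (funext fun x => ?_)).mpr h
  simp only [green, smul_eq_mul]
  have hx := jostWronskian_eq hV κ x
  have hxi : (jostWronskian A V κ)⁻¹ * jostWronskian A V κ = 1 := inv_mul_cancel₀ hW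
  linear_combination (jostWronskian A V κ)⁻¹ * (f x) * hx + (f x) * hxi

theorem lintegral_enorm_sq_lt_top (hf : MemLp f 2 volume) : ∫⁻ y, ‖f y‖ₑ ^ 2 < ⊤ := by
  have := (eLpNorm_lt_top_iff_lintegral_rpow_enorm_lt_top two_ne_zero ENNReal.ofNat_ne_top).1 hf.2
  simpa using this

theorem memLp_two_of_lintegral {μ : Measure ℝ} {g : ℝ → ℂ} (hg : AEStronglyMeasurable g μ)
    (h : ∫⁻ y, ‖g y‖ₑ ^ 2 ∂μ < ⊤) : MemLp g 2 μ := by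
  refine ⟨hg, (eLpNorm_lt_top_iff_lintegral_rpow_enorm_lt_top two_ne_zero
    ENNReal.ofNat_ne_top).2 ?_⟩
  simpa using h

/-- Growth of $m$ at the smaller argument and decay of $p$ at the larger one multiply to
$e^{-\operatorname{Im}\kappa|x-y|}$, so the convolution estimate controls the Green operator on
$L^2$. -/
theorem exists_expKernel_bound (hV : IsPotential A V) (hκ : 0 < κ.im) : ∃ C : ENNReal, C ≠ ⊤ ∧
    (∀ x y, y ≤ x → ‖jostRight A V κ x‖ₑ * ‖jostLeft A V κ y‖ₑ ≤ C * expKernel κ.im x y ∧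
      ‖jostRightDeriv A V κ x‖ₑ * ‖jostLeft A V κ y‖ₑ ≤ C * expKernel κ.im x y) ∧
    (∀ x y, x ≤ y → ‖jostLeft A V κ x‖ₑ * ‖jostRight A V κ y‖ₑ ≤ C * expKernel κ.im x y ∧
      ‖jostLeftDeriv A V κ x‖ₑ * ‖jostRight A V κ y‖ₑ ≤ C * expKernel κ.im x y) := by
  obtain ⟨C₁, hC₁, h₁⟩ := exists_norm_jostLeft_le_exp hV hκ
  obtain ⟨C₂, hC₂, h₂⟩ := exists_norm_jostRight_le_exp hV hκ
  have main : ∀ (a b : ℂ) (s t : ℝ), s ≤ t → ‖a‖ ≤ C₁ * Real.exp (κ.im * s) →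
      ‖b‖ ≤ C₂ * Real.exp (-(κ.im * t)) → ‖a‖ₑ * ‖b‖ₑ ≤
        ENNReal.ofReal (C₁ * C₂) * expKernel κ.im s t := fun a b s t hst ha hb => by
    rw [← enorm_mul, expKernel, ← ENNReal.ofReal_mul (by positivity), ← ofReal_norm, norm_mul]
    apply ENNReal.ofReal_le_ofReal
    calc ‖a‖ * ‖b‖ ≤ C₁ * Real.exp (κ.im * s) * (C₂ * Real.exp (-(κ.im * t))) := by gcongr
      _ = C₁ * C₂ * (Real.exp (κ.im * s) * Real.exp (-(κ.im * t))) := by ring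
      _ = C₁ * C₂ * Real.exp (-(κ.im * |s - t|)) := by
        rw [← Real.exp_add, abs_of_nonpos (by linarith)]
        ring_nf
  refine ⟨ENNReal.ofReal (C₁ * C₂), ENNReal.ofReal_ne_top, fun x y hxy => ?_, fun x y hxy => ?_⟩
  · rw [expKernel_comm, mul_comm, mul_comm ‖jostRightDeriv A V κ x‖ₑ]
    exact ⟨main _ _ _ _ hxy (h₁ y).1 (h₂ x).1, main _ _ _ _ hxy (h₁ y).1 (h₂ x).2⟩
  · exact ⟨main _ _ _ _ hxy (h₁ x).1 (h₂ y).1, main _ _ _ _ hxy (h₁ x).2 (h₂ y).1⟩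

theorem enorm_mul_integral_le {s : Set ℝ} (hs : MeasurableSet s) {a : ℂ} {w : ℝ → ℂ} {C : ENNReal}
    (hC : C ≠ ⊤) {ε x : ℝ} (h : ∀ y ∈ s, ‖a‖ₑ * ‖w y‖ₑ ≤ C * expKernel ε x y) :
    ‖a * ∫ y in s, w y * f y‖ₑ ≤ C * ∫⁻ y in s, expKernel ε x y * ‖f y‖ₑ := by
  rw [enorm_mul, ← lintegral_const_mul' _ _ hC]
  calc ‖a‖ₑ * ‖∫ y in s, w y * f y‖ₑ ≤ ‖a‖ₑ * ∫⁻ y in s, ‖w y * f y‖ₑ := by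
        gcongr; exact enorm_integral_le_lintegral_enorm _
    _ = ∫⁻ y in s, ‖a‖ₑ * ‖w y * f y‖ₑ := (lintegral_const_mul' _ _ enorm_ne_top).symm
    _ ≤ _ := by
        refine setLIntegral_mono' hs fun y hy => ?_
        rw [enorm_mul, ← mul_assoc, ← mul_assoc]
        exact mul_le_mul' (h y hy) le_rfl

theorem greenIntegrable_of_im_pos (hV : IsPotential A V) (hκ : 0 < κ.im) (hf : MemLp f 2 volume) :
    GreenIntegrable A V κ f := by
  have hfin := expConv_lt_top hκ hf.1.enorm (lintegral_enorm_sq_lt_top hf)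
  have hcm := (isJost_jostLeft hV κ).sol.continuous
  have hcp := (isODESol_jostRight hV κ).continuous
  obtain ⟨C₁, hC₁, h₁⟩ := exists_norm_jostLeft_le_exp hV hκ
  obtain ⟨C₂, hC₂, h₂⟩ := exists_norm_jostRight_le_exp hV hκ
  have main : ∀ (s : Set ℝ) (w : ℝ → ℂ) (x D : ℝ), MeasurableSet s → Continuous w →
      (∀ y ∈ s, ‖w y‖ ≤ D * Real.exp (-(κ.im * |x - y|))) → 0 ≤ D →
      IntegrableOn (fun y => w y * f y) s := fun s w x D hs hw hb hD => by
    refine ⟨(hw.aestronglyMeasurable.mul hf.1).restrict, ?_⟩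
    refine (setLIntegral_mono' hs (g := fun y =>
      ENNReal.ofReal D * (expKernel κ.im x y * ‖f y‖ₑ)) fun y hy => ?_).trans_lt ?_
    · rw [enorm_mul, ← mul_assoc]
      gcongr
      rw [expKernel, ← ENNReal.ofReal_mul hD, ← ofReal_norm]
      exact ENNReal.ofReal_le_ofReal (hb y hy)
    · rw [lintegral_const_mul' _ _ ENNReal.ofReal_ne_top]
      exact ENNReal.mul_lt_top ENNReal.ofReal_lt_top
        ((setLIntegral_le_lintegral _ _).trans_lt (hfin x))
  refine fun x => ⟨main _ _ x (C₁ * Real.exp (κ.im * x)) measurableSet_Iic hcm (fun y hy => ?_)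
    (by positivity), main _ _ x (C₂ * Real.exp (-(κ.im * x))) measurableSet_Ioi hcp
    (fun y hy => ?_) (by positivity)⟩
  · refine (h₁ y).1.trans (le_of_eq ?_)
    rw [mul_assoc, ← Real.exp_add, abs_of_nonneg (by linarith [Set.mem_Iic.1 hy])]
    ring_nf
  · refine (h₂ y).1.trans (le_of_eq ?_)
    rw [mul_assoc, ← Real.exp_add, abs_of_neg (by linarith [Set.mem_Ioi.1 hy])]
    ring_nf

theorem memLp_green (hV : IsPotential A V) (hκ : 0 < κ.im) (hW : jostWronskian A V κ ≠ 0)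
    (hf : MemLp f 2 volume) :
    MemLp (green A V κ f) 2 volume ∧ MemLp (greenDeriv A V κ f) 2 volume := by
  have hGI := greenIntegrable_of_im_pos hV hκ hf
  obtain ⟨C, hC, h₁, h₂⟩ := exists_expKernel_bound hV hκ
  have hfin := lintegral_expConv_sq_lt_top hκ hf.1.enorm (lintegral_enorm_sq_lt_top hf)
  have main : ∀ u : ℝ → ℂ, Continuous u → (∀ x, ‖u x‖ₑ ≤ ‖(jostWronskian A V κ)⁻¹‖ₑ *
      (C * expConv κ.im (fun y => ‖f y‖ₑ) x)) → MemLp u 2 volume := fun u hu hb => by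
    refine memLp_two_of_lintegral hu.aestronglyMeasurable ?_
    refine (lintegral_mono fun x => pow_le_pow_left₀ zero_le (hb x) 2).trans_lt ?_
    simp only [mul_pow]
    rw [lintegral_const_mul' _ _ (by finiteness), lintegral_const_mul' _ _ (by finiteness)]
    finiteness
  have split : ∀ x, (∫⁻ y in Set.Iic x, expKernel κ.im x y * ‖f y‖ₑ) +
      ∫⁻ y in Set.Ioi x, expKernel κ.im x y * ‖f y‖ₑ = expConv κ.im (fun y => ‖f y‖ₑ) x :=
    fun x => by
      rw [← Set.compl_Iic, lintegral_add_compl _ measurableSet_Iic]; rfl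
  refine ⟨main _ (isPrimitive_green hV hGI).continuous fun x => ?_,
    main _ (isPrimitive_greenDeriv hV hGI hW).continuous fun x => ?_⟩
  · rw [green, enorm_mul, ← split, mul_add]
    gcongr
    exact (enorm_add_le _ _).trans (add_le_add
      (enorm_mul_integral_le measurableSet_Iic hC fun y hy => (h₁ x y hy).1)
      (enorm_mul_integral_le measurableSet_Ioi hC fun y hy => (h₂ x y (le_of_lt hy)).1))
  · rw [greenDeriv, enorm_mul, ← split, mul_add]
    gcongr
    exact (enorm_add_le _ _).trans (add_le_add
      (enorm_mul_integral_le measurableSet_Iic hC fun y hy => (h₁ x y hy).2)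
      (enorm_mul_integral_le measurableSet_Ioi hC fun y hy => (h₂ x y (le_of_lt hy)).2))

theorem IsPotential.memLp_mul (hV : IsPotential A V) {u : ℝ → ℂ} (hu : MemLp u 2 volume) :
    MemLp (fun x => (V x : ℂ) * u x) 2 volume := by
  obtain ⟨M, -, hM⟩ := hV.exists_bound
  have hc := hV.cont
  refine hu.of_le_mul (c := M) ((by fun_prop : Continuous fun x => (V x : ℂ)).aestronglyMeasurable.mul
    hu.1) (ae_of_all _ fun x => ?_)
  rw [norm_mul, Complex.norm_real]
  gcongr
  exact hM x

theorem solvesSchrodinger_green (hV : IsPotential A V) (hκ : 0 < κ.im)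
    (hW : jostWronskian A V κ ≠ 0) (hf : MemLp f 2 volume) :
    SolvesSchrodinger V (κ ^ 2) f (green A V κ f) := by
  have hGI := greenIntegrable_of_im_pos hV hκ hf
  obtain ⟨h1, h2⟩ := memLp_green hV hκ hW hf
  exact solvesSchrodinger_iff.2 ⟨((hV.memLp_mul h1).sub (h1.const_mul _)).sub hf, _, _, ae_eq_refl _,
    isPrimitive_green hV hGI, isPrimitive_greenDeriv hV hGI hW, h1, h2⟩

/-- A square integrable solution is proportional to the Jost solution at `-∞`. -/
theorem IsODESol.mul_jostLeftDeriv_eq (hV : IsPotential A V) (hκ : 0 < κ.im) {u u₁ : ℝ → ℂ}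
    (h : IsODESol (fun x => (V x : ℂ) - κ ^ 2) u u₁) (hu : MemLp u 2 volume)
    (hu₁ : MemLp u₁ 2 volume) (x : ℝ) :
    u x * jostLeftDeriv A V κ x - u₁ x * jostLeft A V κ x = 0 := by
  have hm := (isJost_jostLeft hV κ).sol
  obtain ⟨C, hC, hb⟩ := exists_norm_jostLeft_le_exp hV hκ
  set c := u x * jostLeftDeriv A V κ x - u₁ x * jostLeft A V κ x
  have hE : MemLp (fun y : ℝ => Real.exp (κ.im * y)) 2 (volume.restrict (Set.Iic 0)) := by
    refine (memLp_two_iff_integrable_sq (by fun_prop)).2 ?_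
    refine (integrableOn_exp_mul_Iic (a := 2 * κ.im) (by linarith) 0).congr_fun (fun y _ => ?_)
      measurableSet_Iic
    simp only [← Real.exp_nat_mul]; push_cast; ring_nf
  have hM : ∀ w : ℝ → ℂ, Continuous w → (∀ y, ‖w y‖ ≤ C * Real.exp (κ.im * y)) →
      MemLp w 2 (volume.restrict (Set.Iic 0)) := fun w hw hwb =>
    hE.of_le_mul hw.aestronglyMeasurable (ae_of_all _ fun y => by
      rw [Real.norm_eq_abs, abs_of_pos (Real.exp_pos _)]; exact hwb y)
  -- The Wronskian of $u$ and $m$ is constant, and on $(-\infty,0]$ it is a combination of products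
  -- of $L^2$ functions. A constant integrable on a half-line vanishes.
  have hI : Integrable (fun y => u y * jostLeftDeriv A V κ y - u₁ y * jostLeft A V κ y)
      (volume.restrict (Set.Iic 0)) :=
    ((hu.restrict _).integrable_mul (hM _ hm.continuous_snd fun y => (hb y).2)).sub
      ((hu₁.restrict _).integrable_mul (hM _ hm.continuous fun y => (hb y).1))
  have hcst : (fun y => u y * jostLeftDeriv A V κ y - u₁ y * jostLeft A V κ y) = fun _ => c :=
    funext fun y => h.wronskian_eq hm y x
  rw [hcst, integrable_const_iff] at hI
  rcases hI with hI | hI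
  · exact hI
  · have := hI.measure_univ_lt_top
    simp at this

theorem IsODESol.mul_jostRightDeriv_eq (hV : IsPotential A V) (hκ : 0 < κ.im) {u u₁ : ℝ → ℂ}
    (h : IsODESol (fun x => (V x : ℂ) - κ ^ 2) u u₁) (hu : MemLp u 2 volume)
    (hu₁ : MemLp u₁ 2 volume) (x : ℝ) :
    u x * jostRightDeriv A V κ x - u₁ x * jostRight A V κ x = 0 := by
  have hn := Measure.measurePreserving_neg (volume : Measure ℝ)
  have := h.comp_neg.mul_jostLeftDeriv_eq hV.comp_neg hκ (hu.comp_measurePreserving hn)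
    (hu₁.comp_measurePreserving hn).neg (-x)
  simp only [neg_neg] at this
  rw [jostRightDeriv, jostRight]
  linear_combination -this

/-- The difference $d$ of two solutions has zero Wronskian with both Jost solutions. Eliminating
$d'$ leaves $d\,W=0$. -/
theorem SolvesSchrodinger.ae_unique (hV : IsPotential A V) (hκ : 0 < κ.im)
    (hW : jostWronskian A V κ ≠ 0) {u w : ℝ → ℂ} (hu : SolvesSchrodinger V (κ ^ 2) f u)
    (hw : SolvesSchrodinger V (κ ^ 2) f w) : u =ᵐ[volume] w := by
  obtain ⟨-, u₀, u₁, eu, pu, pu₁, mu, mu₁⟩ := solvesSchrodinger_iff.1 hu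
  obtain ⟨-, w₀, w₁, ew, pw, pw₁, mw, mw₁⟩ := solvesSchrodinger_iff.1 hw
  have hVc := hV.cont
  have c0 := pu.continuous
  have c1 := pu₁.continuous
  have c2 := pw.continuous
  have c3 := pw₁.continuous
  have hneg : ∀ a b : ℝ → ℂ, IsPrimitive a b → IsPrimitive (fun x => -a x) (fun x => -b x) :=
    fun a b hab => ⟨hab.1.neg, fun s t => by
      rw [intervalIntegral.integral_neg, ← hab.2]; ring⟩
  have pd := pu.add (hneg _ _ pw)
  have pd₁ : IsPrimitive (fun x => u₁ x + -w₁ x)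
      (fun x => ((V x : ℂ) - κ ^ 2) * (u₀ x + -w₀ x)) := by
    refine (pu₁.add (hneg _ _ pw₁)).congr (ae_of_all _ fun x => ?_)
    ring
  have hS : IsODESol (fun x => (V x : ℂ) - κ ^ 2) (fun x => u₀ x + -w₀ x)
      (fun x => u₁ x + -w₁ x) :=
    ⟨pd.hasDerivAt (by fun_prop), pd₁.hasDerivAt (by fun_prop)⟩
  have z1 := hS.mul_jostLeftDeriv_eq hV hκ (mu.add mw.neg) (mu₁.add mw₁.neg)
  have z2 := hS.mul_jostRightDeriv_eq hV hκ (mu.add mw.neg) (mu₁.add mw₁.neg)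
  filter_upwards [eu, ew] with x hx hx'
  have e : (u₀ x + -w₀ x) * jostWronskian A V κ = 0 := by
    rw [← jostWronskian_eq hV κ x]
    linear_combination jostRight A V κ x * z1 x - jostLeft A V κ x * z2 x
  rw [hx, hx', ← sub_eq_zero, sub_eq_add_neg]
  exact (mul_eq_zero.1 e).resolve_right hW

theorem inResolventSet_of_jostWronskian_ne_zero (hV : IsPotential A V) (hκ : 0 < κ.im)
    (hW : jostWronskian A V κ ≠ 0) : InResolventSet V (κ ^ 2) := fun _ hf =>
  ⟨⟨_, solvesSchrodinger_green hV hκ hW hf⟩, fun _ _ hu hw => hu.ae_unique hV hκ hW hw⟩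

theorem schrodingerResolvent_ae_eq (hV : IsPotential A V) (hκ : 0 < κ.im)
    (hW : jostWronskian A V κ ≠ 0) (hf : MemLp f 2 volume) :
    schrodingerResolvent V (κ ^ 2) f =ᵐ[volume] green A V κ f := by
  have hex : ∃ u, SolvesSchrodinger V (κ ^ 2) f u := ⟨_, solvesSchrodinger_green hV hκ hW hf⟩
  rw [schrodingerResolvent, dif_pos hex]
  exact hex.choose_spec.ae_unique hV hκ hW (solvesSchrodinger_green hV hκ hW hf)

end

/-! ### Limiting absorption at real frequencies -/

section

variable {A : ℝ} {V : ℝ → ℝ}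

theorem continuous_jostLeft_apply (hV : IsPotential A V) (x : ℝ) :
    (Continuous fun κ => jostLeft A V κ x) ∧ Continuous fun κ => jostLeftDeriv A V κ x := by
  rcases le_total x (-A) with hx | hx
  · have h1 : (fun κ => jostLeft A V κ x) = fun κ => Complex.exp (-(Complex.I * κ) * x) :=
      funext fun κ => (isJost_jostLeft hV κ).left x hx
    have h2 : (fun κ => jostLeftDeriv A V κ x) =
        fun κ => -(Complex.I * κ) * Complex.exp (-(Complex.I * κ) * x) :=
      funext fun κ => (isJost_jostLeft hV κ).left_snd x hx
    rw [h1, h2]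
    constructor <;> fun_prop
  · have key := fun (l : ℂ) (η : ℝ) (hη : 0 < η) => jostLeft_continuity hV l x hη
    constructor <;> refine continuous_iff_continuousAt.2 fun l => Metric.continuousAt_iff.2 fun η hη => ?_ <;>
      obtain ⟨δ, hδ, h⟩ := key l (η / 2) (by positivity) <;> refine ⟨δ, hδ, fun {κ} hκ => ?_⟩ <;>
      have := h V hV (fun x => by simpa using hδ.le) κ (by rw [← dist_eq_norm]; exact hκ.le) x
        ⟨hx, le_rfl⟩ <;> rw [dist_eq_norm]
    · linarith [this.1]
    · linarith [this.2]

theorem continuous_jostRight_apply (hV : IsPotential A V) (x : ℝ) :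
    (Continuous fun κ => jostRight A V κ x) ∧ Continuous fun κ => jostRightDeriv A V κ x :=
  ⟨(continuous_jostLeft_apply hV.comp_neg (-x)).1, (continuous_jostLeft_apply hV.comp_neg (-x)).2.neg⟩

theorem continuous_jostWronskian (hV : IsPotential A V) : Continuous (jostWronskian A V) :=
  ((continuous_jostRight_apply hV 0).1.mul (continuous_jostLeft_apply hV 0).2).sub
    ((continuous_jostRight_apply hV 0).2.mul (continuous_jostLeft_apply hV 0).1)

/-- Supplies domination on a whole half-line, uniformly as $\kappa$ approaches $l$: left of the
support $|e^{-i\kappa x}|\le1$ because $\operatorname{Im}\kappa\ge0$ and $x\le0$, and the rest is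
compact. -/
theorem exists_norm_jostLeft_le (hV : IsPotential A V) (l : ℂ) (r : ℝ) :
    ∃ B, 0 ≤ B ∧ ∀ᶠ κ in 𝓝 l, 0 ≤ κ.im → ∀ x ≤ r, ‖jostLeft A V κ x‖ ≤ B := by
  obtain ⟨δ, hδ, h⟩ := jostLeft_continuity hV l r one_pos
  obtain ⟨B, hB⟩ := isCompact_Icc.exists_bound_of_continuousOn (s := Set.Icc (-A) r)
    (isJost_jostLeft hV l).sol.continuous.continuousOn
  refine ⟨|B| + 1, by positivity, ?_⟩
  filter_upwards [Metric.closedBall_mem_nhds l hδ] with κ hκ him x hx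
  rcases le_total x (-A) with hx' | hx'
  · rw [(isJost_jostLeft hV κ).left x hx', norm_exp_neg_I_mul]
    have : Real.exp (κ.im * x) ≤ 1 := Real.exp_le_one_iff.2
      (mul_nonpos_of_nonneg_of_nonpos him (by linarith [hV.pos]))
    linarith [abs_nonneg B]
  · have h1 := (h V hV (fun x => by simpa using hδ.le) κ (by simpa [dist_eq_norm] using hκ) x
      ⟨hx', hx⟩).1
    have h2 := norm_le_norm_add_norm_sub' (jostLeft A V κ x) (jostLeft A V l x)
    linarith [hB x ⟨hx', hx⟩, le_abs_self B]

theorem exists_norm_jostRight_le (hV : IsPotential A V) (l : ℂ) (r : ℝ) :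
    ∃ B, 0 ≤ B ∧ ∀ᶠ κ in 𝓝 l, 0 ≤ κ.im → ∀ x, -r ≤ x → ‖jostRight A V κ x‖ ≤ B := by
  obtain ⟨B, hB0, hB⟩ := exists_norm_jostLeft_le hV.comp_neg l r
  exact ⟨B, hB0, hB.mono fun κ h him x hx => h him (-x) (by linarith)⟩

theorem IntegrableOn.bounded_mul {s : Set ℝ} (hs : MeasurableSet s) {w f : ℝ → ℂ}
    (hw : Continuous w) (hf : Integrable f) {B : ℝ} (hB : ∀ y ∈ s, ‖w y‖ ≤ B) :
    IntegrableOn (fun y => w y * f y) s :=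
  hf.integrableOn.bdd_mul hw.aestronglyMeasurable (ae_restrict_of_forall_mem hs hB)

theorem greenIntegrable_of_integrable (hV : IsPotential A V) {κ : ℂ} (hκ : 0 ≤ κ.im) {f : ℝ → ℂ}
    (hf : Integrable f) : GreenIntegrable A V κ f := by
  intro x
  obtain ⟨B, -, hB⟩ := exists_norm_jostLeft_le hV κ x
  obtain ⟨B', -, hB'⟩ := exists_norm_jostRight_le hV κ (-x)
  exact ⟨IntegrableOn.bounded_mul measurableSet_Iic (isJost_jostLeft hV κ).sol.continuous hf
      (hB.self_of_nhds hκ),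
    IntegrableOn.bounded_mul measurableSet_Ioi (isODESol_jostRight hV κ).continuous hf
      fun y hy => hB'.self_of_nhds hκ y (by rw [neg_neg]; exact le_of_lt hy)⟩

theorem norm_integral_mul_le {s : Set ℝ} (hs : MeasurableSet s) {w f : ℝ → ℂ} {B : ℝ}
    (hf : Integrable f) (hB : ∀ y ∈ s, f y ≠ 0 → ‖w y‖ ≤ B) :
    ‖∫ y in s, w y * f y‖ ≤ B * ∫ y in s, ‖f y‖ := by
  rw [← integral_const_mul]
  refine norm_integral_le_of_norm_le (hf.norm.integrableOn.const_mul B)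
    (ae_restrict_of_forall_mem hs fun y hy => ?_)
  rw [norm_mul]
  by_cases h : f y = 0
  · simp [h]
  · gcongr
    exact hB y hy h

/-- Bounds are demanded only where they matter: on the outer factors when their integrals are
nonzero, on the inner ones where $f\ne0$. For compactly supported $f$ this yields estimates on all
of $\mathbb R$ although the Jost solutions are controlled only on half-lines. -/
theorem norm_mul_add_mul_integral_le {f p m : ℝ → ℂ} {a b c : ℂ} {B D x : ℝ} (hf : Integrable f)
    (ha : (∫ y in Set.Iic x, m y * f y) ≠ 0 → ‖a‖ ≤ D)
    (hb : (∫ y in Set.Ioi x, p y * f y) ≠ 0 → ‖b‖ ≤ D)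
    (hD : 0 ≤ D) (hm : ∀ y ≤ x, f y ≠ 0 → ‖m y‖ ≤ B) (hp : ∀ y, x < y → f y ≠ 0 → ‖p y‖ ≤ B) :
    ‖c⁻¹ * (a * (∫ y in Set.Iic x, m y * f y) + b * ∫ y in Set.Ioi x, p y * f y)‖ ≤
      D * B * (∫ y, ‖f y‖) / ‖c‖ := by
  have e : ∫ y, ‖f y‖ = (∫ y in Set.Iic x, ‖f y‖) + ∫ y in Set.Ioi x, ‖f y‖ := by
    rw [← Set.compl_Iic, integral_add_compl measurableSet_Iic hf.norm]
  have n : ∀ a I : ℂ, (I ≠ 0 → ‖a‖ ≤ D) → ‖a * I‖ ≤ D * ‖I‖ := fun a I h => by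
    rw [norm_mul]
    by_cases hI : I = 0
    · simp [hI]
    · gcongr
      exact h hI
  rw [norm_mul, norm_inv, inv_mul_eq_div]
  gcongr
  calc _ ≤ D * (B * ∫ y in Set.Iic x, ‖f y‖) + D * (B * ∫ y in Set.Ioi x, ‖f y‖) := by
        refine norm_add_le_of_le ((n _ _ ha).trans ?_) ((n _ _ hb).trans ?_)
        · gcongr; exact norm_integral_mul_le measurableSet_Iic hf hm
        · gcongr; exact norm_integral_mul_le measurableSet_Ioi hf hp
    _ = D * B * ∫ y, ‖f y‖ := by rw [e]; ring

instance neBot_nhdsWithin_im_pos (k : ℝ) : (𝓝[{κ : ℂ | 0 < κ.im}] (k : ℂ)).NeBot := by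
  rw [← mem_closure_iff_nhdsWithin_neBot, Complex.closure_setOfPred_lt_im]
  simp

theorem eventually_jostWronskian_ne_zero (hV : IsPotential A V) {k : ℝ}
    (hW : jostWronskian A V k ≠ 0) :
    ∀ᶠ κ in 𝓝[{κ : ℂ | 0 < κ.im}] (k : ℂ), 0 < κ.im ∧ jostWronskian A V κ ≠ 0 :=
  eventually_mem_nhdsWithin.and
    (nhdsWithin_le_nhds ((continuous_jostWronskian hV).continuousAt.eventually_ne hW))

/-- Dominated convergence in both integrals. The source may vary with $\kappa$, as it does in the
second resolvent identity, where it is $(U-V)R_V(\kappa)f$. -/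
theorem tendsto_green (hV : IsPotential A V) {k : ℝ} (hW : jostWronskian A V k ≠ 0)
    {f : ℂ → ℝ → ℂ} {g : ℝ → ℂ} {F : ℝ → ℝ} (hF : Integrable F)
    (hfm : ∀ᶠ κ in 𝓝[{κ : ℂ | 0 < κ.im}] (k : ℂ), AEStronglyMeasurable (f κ) volume)
    (hfF : ∀ᶠ κ in 𝓝[{κ : ℂ | 0 < κ.im}] (k : ℂ), ∀ x, ‖f κ x‖ ≤ F x)
    (hfg : ∀ x, Tendsto (fun κ => f κ x) (𝓝[{κ : ℂ | 0 < κ.im}] (k : ℂ)) (𝓝 (g x))) (x : ℝ) :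
    Tendsto (fun κ => green A V κ (f κ) x) (𝓝[{κ : ℂ | 0 < κ.im}] (k : ℂ))
      (𝓝 (green A V k g x)) := by
  set l := 𝓝[{κ : ℂ | 0 < κ.im}] (k : ℂ)
  have him : ∀ᶠ κ in l, 0 < κ.im := eventually_mem_nhdsWithin
  have hlim : ∀ {w : ℂ → ℂ}, Continuous w → Tendsto w l (𝓝 (w k)) := fun hw =>
    (hw.tendsto _).mono_left nhdsWithin_le_nhds
  have main : ∀ (s : Set ℝ), MeasurableSet s → ∀ (w : ℂ → ℝ → ℂ), (∀ κ, Continuous (w κ)) →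
      (∀ y, Continuous fun κ => w κ y) → ∀ B, (∀ᶠ κ in l, ∀ y ∈ s, ‖w κ y‖ ≤ B) →
      Tendsto (fun κ => ∫ y in s, w κ y * f κ y) l (𝓝 (∫ y in s, w k y * g y)) :=
    fun s hs w hw hw' B hB => by
      refine tendsto_integral_filter_of_dominated_convergence (fun y => |B| * F y) ?_ ?_
        (hF.integrableOn.const_mul _) (ae_of_all _ fun y => (hlim (hw' y)).mul (hfg y))
      · filter_upwards [hfm] with κ h
        exact ((hw κ).aestronglyMeasurable.mul h).restrict
      · filter_upwards [hB, hfF] with κ h1 h2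
        refine ae_restrict_of_forall_mem hs fun y hy => ?_
        rw [norm_mul]
        exact mul_le_mul ((h1 y hy).trans (le_abs_self B)) (h2 y) (norm_nonneg _) (abs_nonneg _)
  obtain ⟨B, -, hB⟩ := exists_norm_jostLeft_le hV k x
  obtain ⟨B', -, hB'⟩ := exists_norm_jostRight_le hV k (-x)
  have h1 := main (Set.Iic x) measurableSet_Iic (jostLeft A V)
    (fun κ => (isJost_jostLeft hV κ).sol.continuous)
    (fun y => (continuous_jostLeft_apply hV y).1) B (by
      filter_upwards [him, nhdsWithin_le_nhds hB] with κ h h' y hy using h' h.le y hy)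
  have h2 := main (Set.Ioi x) measurableSet_Ioi (jostRight A V)
    (fun κ => (isODESol_jostRight hV κ).continuous)
    (fun y => (continuous_jostRight_apply hV y).1) B' (by
      filter_upwards [him, nhdsWithin_le_nhds hB'] with κ h h' y hy
      exact h' h.le y (by rw [neg_neg]; exact le_of_lt hy))
  exact ((hlim (continuous_jostWronskian hV)).inv₀ hW).mul
    (((hlim (continuous_jostRight_apply hV x).1).mul h1).add
      ((hlim (continuous_jostLeft_apply hV x).1).mul h2))

theorem eventually_norm_green_le (hV : IsPotential A V) {k : ℝ} (hW : jostWronskian A V k ≠ 0)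
    {f : ℝ → ℂ} (hf : Integrable f) (r : ℝ) :
    ∃ B, ∀ᶠ κ in 𝓝[{κ : ℂ | 0 < κ.im}] (k : ℂ), ∀ x ∈ Set.Icc (-r) r, ‖green A V κ f x‖ ≤ B := by
  obtain ⟨B, hB0, hB⟩ := exists_norm_jostLeft_le hV k r
  obtain ⟨B', hB0', hB'⟩ := exists_norm_jostRight_le hV k r
  have hc : Tendsto (fun κ => (B + B') * (B + B') * (∫ y, ‖f y‖) / ‖jostWronskian A V κ‖)
      (𝓝[{κ : ℂ | 0 < κ.im}] (k : ℂ))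
      (𝓝 ((B + B') * (B + B') * (∫ y, ‖f y‖) / ‖jostWronskian A V k‖)) :=
    tendsto_const_nhds.div (((continuous_jostWronskian hV).tendsto _).mono_left
      nhdsWithin_le_nhds).norm (norm_ne_zero_iff.2 hW)
  refine ⟨(B + B') * (B + B') * (∫ y, ‖f y‖) / ‖jostWronskian A V k‖ + 1, ?_⟩
  filter_upwards [hc.eventually (gt_mem_nhds (lt_add_one _)), eventually_mem_nhdsWithin,
    nhdsWithin_le_nhds hB, nhdsWithin_le_nhds hB'] with κ h1 h2 h3 h4 x hx
  have h2' : 0 ≤ κ.im := le_of_lt h2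
  refine le_trans ?_ h1.le
  refine norm_mul_add_mul_integral_le hf (fun _ => ?_) (fun _ => ?_) (by positivity)
    (fun y hy _ => ?_) (fun y hy _ => ?_)
  · linarith [h4 h2' x hx.1]
  · linarith [h3 h2' x hx.2]
  · linarith [h3 h2' y (hy.trans hx.2)]
  · linarith [h4 h2' y (hx.1.trans hy.le)]

/-- Pointwise convergence of the Green functions together with a bound uniform on $[-r,r]$ gives
convergence in $L^2(-r,r)$. -/
theorem isOutgoingLimit_green (hV : IsPotential A V) {k : ℝ} (hW : jostWronskian A V k ≠ 0)
    {f : ℝ → ℂ} (hf : Integrable f) (hf2 : MemLp f 2 volume) :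
    IsOutgoingLimit V k f (green A V k f) := by
  have hev := eventually_jostWronskian_ne_zero hV hW
  refine ⟨hev.mono fun κ h => inResolventSet_of_jostWronskian_ne_zero hV h.1 h.2, fun r => ?_⟩
  have hpt := fun x => tendsto_green hV hW (f := fun _ => f) hf.norm
    (Eventually.of_forall fun _ => hf.1) (Eventually.of_forall fun _ _ => le_rfl)
    (fun x => tendsto_const_nhds) x
  obtain ⟨B, hB⟩ := eventually_norm_green_le hV hW hf r
  have hBk : ∀ x ∈ Set.Icc (-r) r, ‖green A V k f x‖ ≤ B := fun x hx =>
    le_of_tendsto (hpt x).norm (hB.mono fun κ h => h x hx)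
  have hck : Continuous (green A V k f) :=
    (isPrimitive_green hV (greenIntegrable_of_integrable hV (by simp) hf)).continuous
  refine ⟨(memLp_top_of_bound hck.aestronglyMeasurable B
    (ae_restrict_of_forall_mem measurableSet_Icc hBk)).mono_exponent le_top, ?_⟩
  have hlim : Tendsto (fun κ : ℂ => eLpNorm (green A V κ f - green A V k f) 2
      (volume.restrict (Set.Icc (-r) r))) (𝓝[{κ : ℂ | 0 < κ.im}] (k : ℂ)) (𝓝 0) := by
    have h1 : Tendsto (fun κ : ℂ => ∫⁻ x in Set.Icc (-r) r, ‖(green A V κ f - green A V k f) x‖ₑ ^ (2 : ℝ))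
        (𝓝[{κ : ℂ | 0 < κ.im}] (k : ℂ)) (𝓝 (∫⁻ x in Set.Icc (-r) r, 0)) := by
      refine tendsto_lintegral_filter_of_dominated_convergence
        (fun _ => ENNReal.ofReal (B + B) ^ (2 : ℝ)) ?_ ?_ ?_ (ae_of_all _ fun x => ?_)
      · filter_upwards [hev] with κ hκ
        have : Continuous (green A V κ f) :=
          (isPrimitive_green hV (greenIntegrable_of_integrable hV hκ.1.le hf)).continuous
        exact ((this.sub hck).enorm.measurable).pow_const _
      · filter_upwards [hB] with κ hκ
        refine ae_restrict_of_forall_mem measurableSet_Icc fun x hx => ?_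
        gcongr
        rw [← ofReal_norm]
        exact ENNReal.ofReal_le_ofReal (norm_sub_le_of_le (hκ x hx) (hBk x hx))
      · simp only [lintegral_const, Measure.restrict_apply_univ, Real.volume_Icc]
        finiteness
      · have h0 : Tendsto (fun κ => ‖(green A V κ f - green A V k f) x‖ₑ)
            (𝓝[{κ : ℂ | 0 < κ.im}] (k : ℂ)) (𝓝 0) := by
          have := ((hpt x).sub_const (green A V k f x)).enorm
          simpa using this
        have := h0.ennrpow_const 2
        simpa using this
    rw [lintegral_zero] at h1
    have h2 := h1.ennrpow_const (1 / 2)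
    rw [ENNReal.zero_rpow_of_pos (by norm_num)] at h2
    refine h2.congr fun κ => ?_
    rw [eLpNorm_eq_lintegral_rpow_enorm_toReal two_ne_zero ENNReal.ofNat_ne_top]
    simp
  refine hlim.congr' ?_
  filter_upwards [hev] with κ hκ
  refine eLpNorm_congr_ae (ae_restrict_of_ae ?_)
  filter_upwards [schrodingerResolvent_ae_eq hV hκ.1 hκ.2 hf2] with x hx
  simp [hx]

/-- The triangle inequality on each $[-n,n]$. Since `outgoingResolvent` is a chosen limit, this is
what identifies it with the Green function. -/
theorem IsOutgoingLimit.ae_unique {k : ℝ} {f ψ χ : ℝ → ℂ} (hψ : IsOutgoingLimit V k f ψ)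
    (hχ : IsOutgoingLimit V k f χ) (hm : ∀ᶠ κ in 𝓝[{κ : ℂ | 0 < κ.im}] (k : ℂ),
      AEStronglyMeasurable (schrodingerResolvent V (κ ^ 2) f) volume) : ψ =ᵐ[volume] χ := by
  have main : ∀ n : ℕ, ψ =ᵐ[volume.restrict (Set.Icc (-n : ℝ) n)] χ := fun n => by
    obtain ⟨m1, t1⟩ := hψ.2 n
    obtain ⟨m2, t2⟩ := hχ.2 n
    have hle : eLpNorm (ψ - χ) 2 (volume.restrict (Set.Icc (-n : ℝ) n)) ≤ 0 := by
      have t3 := t1.add t2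
      rw [add_zero] at t3
      refine ge_of_tendsto t3 ?_
      filter_upwards [hm] with κ hκ
      have e : ψ - χ = (schrodingerResolvent V (κ ^ 2) f - χ) -
          (schrodingerResolvent V (κ ^ 2) f - ψ) := by abel
      rw [e, add_comm]
      exact eLpNorm_sub_le (hκ.restrict.sub m2.1) (hκ.restrict.sub m1.1) (by norm_num)
    have := (eLpNorm_eq_zero_iff (m1.1.sub m2.1) two_ne_zero).1 (le_antisymm hle zero_le)
    filter_upwards [this] with x hx
    simpa [sub_eq_zero] using hx
  have hU : (⋃ n : ℕ, Set.Icc (-n : ℝ) n) = Set.univ := Set.eq_univ_of_forall fun x => by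
    obtain ⟨n, hn⟩ := exists_nat_ge |x|
    exact Set.mem_iUnion.2 ⟨n, abs_le.1 hn⟩
  rw [← Measure.restrict_univ (μ := (volume : Measure ℝ)), ← hU]
  exact (ae_restrict_iUnion_iff _ _).2 main

theorem outgoingResolvent_spec (hV : IsPotential A V) {k : ℝ} (hW : jostWronskian A V k ≠ 0)
    {f : ℝ → ℂ} (hf : Integrable f) (hf2 : MemLp f 2 volume) :
    IsOutgoingLimit V k f (outgoingResolvent V k f) ∧
      outgoingResolvent V k f =ᵐ[volume] green A V k f := by
  have hG := isOutgoingLimit_green hV hW hf hf2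
  have hex : ∃ ψ, IsOutgoingLimit V k f ψ := ⟨_, hG⟩
  have h1 : IsOutgoingLimit V k f (outgoingResolvent V k f) := by
    rw [outgoingResolvent, dif_pos hex]
    exact hex.choose_spec
  refine ⟨h1, h1.ae_unique hG ?_⟩
  filter_upwards [eventually_jostWronskian_ne_zero hV hW] with κ hκ
  exact (memLp_green hV hκ.1 hκ.2 hf2).1.1.congr (schrodingerResolvent_ae_eq hV hκ.1 hκ.2 hf2).symm

end

/-! ### The second resolvent identity and bounds uniform in the frequency -/

section

variable {A : ℝ} {V U : ℝ → ℝ}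

theorem IsPotential.sub (hU : IsPotential A U) (hV : IsPotential A V) :
    IsPotential A (fun x => U x - V x) :=
  ⟨hU.pos, hU.cont.sub hV.cont, fun x hx => by rw [hU.zero x hx, hV.zero x hx, sub_zero]⟩

theorem IsPotential.abs_lt_of_ne_zero (hV : IsPotential A V) {x : ℝ} (hx : V x ≠ 0) : |x| < A :=
  not_le.1 fun h => hx (hV.zero x h)

theorem IsPrimitive.sub {u v u₁ v₁ : ℝ → ℂ} (h : IsPrimitive u v) (h₁ : IsPrimitive u₁ v₁) :
    IsPrimitive (fun x => u x - u₁ x) (fun x => v x - v₁ x) :=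
  ⟨h.1.sub h₁.1, fun a b => by
    rw [intervalIntegral.integral_sub (h.intervalIntegrable a b) (h₁.intervalIntegrable a b),
      ← h.2, ← h₁.2]; ring⟩

/-- The second resolvent identity in the upper half plane. -/
theorem green_sub_green_of_im_pos (hV : IsPotential A V) (hU : IsPotential A U) {κ : ℂ}
    (hκ : 0 < κ.im) (hWV : jostWronskian A V κ ≠ 0) (hWU : jostWronskian A U κ ≠ 0) {f : ℝ → ℂ}
    (hf : MemLp f 2 volume) (x : ℝ) :
    green A V κ f x - green A U κ f x =
      green A U κ (fun y => ((U y - V y : ℝ) : ℂ) * green A V κ f y) x := by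
  have hfV := greenIntegrable_of_im_pos hV hκ hf
  have hfU := greenIntegrable_of_im_pos hU hκ hf
  obtain ⟨mV, mV'⟩ := memLp_green hV hκ hWV hf
  obtain ⟨mU, mU'⟩ := memLp_green hU hκ hWU hf
  have hg : MemLp (fun y => ((U y - V y : ℝ) : ℂ) * green A V κ f y) 2 volume :=
    (hU.sub hV).memLp_mul mV
  have pd := (isPrimitive_green hV hfV).sub (isPrimitive_green hU hfU)
  have pd₁ := (isPrimitive_greenDeriv hV hfV hWV).sub (isPrimitive_greenDeriv hU hfU hWU)
  -- The difference of the resolvents solves the $U$-equation with source $(U-V)R_Vf$, so uniqueness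
  -- in $H^2$ gives the identity.
  have hS : SolvesSchrodinger U (κ ^ 2) (fun y => ((U y - V y : ℝ) : ℂ) * green A V κ f y)
      (fun x => green A V κ f x - green A U κ f x) := by
    refine solvesSchrodinger_iff.2 ⟨((hU.memLp_mul (mV.sub mU)).sub ((mV.sub mU).const_mul _)).sub hg,
      _, _, ae_eq_refl _, pd, pd₁.congr (ae_of_all _ fun x => ?_), mV.sub mU, mV'.sub mU'⟩
    push_cast; ring
  have hae := hS.ae_unique hU hκ hWU (solvesSchrodinger_green hU hκ hWU hg)
  exact congrFun ((Continuous.ae_eq_iff_eq volume pd.continuous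
    (isPrimitive_green hU (greenIntegrable_of_im_pos hU hκ hg)).continuous).1 hae) x

/-- The second resolvent identity at real frequencies. -/
theorem green_sub_green (hV : IsPotential A V) (hU : IsPotential A U) {k : ℝ}
    (hWV : jostWronskian A V k ≠ 0) (hWU : jostWronskian A U k ≠ 0) {f : ℝ → ℂ}
    (hf : Integrable f) (hf2 : MemLp f 2 volume) (x : ℝ) :
    green A V k f x - green A U k f x =
      green A U k (fun y => ((U y - V y : ℝ) : ℂ) * green A V k f y) x := by
  have hlim : ∀ {V}, IsPotential A V → jostWronskian A V k ≠ 0 → ∀ x,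
      Tendsto (fun κ => green A V κ f x) (𝓝[{κ : ℂ | 0 < κ.im}] (k : ℂ)) (𝓝 (green A V k f x)) :=
    fun hV hW x => tendsto_green hV hW (f := fun _ => f) hf.norm
      (Eventually.of_forall fun _ => hf.1) (Eventually.of_forall fun _ _ => le_rfl)
      (fun x => tendsto_const_nhds) x
  obtain ⟨B, hB⟩ := eventually_norm_green_le hV hWV hf A
  obtain ⟨D, hD0, hD⟩ := (hU.sub hV).exists_bound
  have hevV := eventually_jostWronskian_ne_zero hV hWV
  have hc := (hU.sub hV).cont
  -- The identity is passed to the real axis; the moving source is dominated by a constant on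
  -- $[-A,A]$, where $U-V$ is supported.
  have hR := tendsto_green hU hWU
    (f := fun κ y => ((U y - V y : ℝ) : ℂ) * green A V κ f y)
    (g := fun y => ((U y - V y : ℝ) : ℂ) * green A V k f y)
    (F := Set.indicator (Set.Icc (-A) A) fun _ => D * |B|)
    ((integrable_indicator_iff measurableSet_Icc).2 (integrableOn_const (by simp)))
    (hevV.mono fun κ h => by
      have : Continuous (green A V κ f) :=
        (isPrimitive_green hV (greenIntegrable_of_integrable hV h.1.le hf)).continuous
      exact (by fun_prop : Continuous fun y =>
        ((U y - V y : ℝ) : ℂ) * green A V κ f y).aestronglyMeasurable)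
    (hB.mono fun κ h y => by
      by_cases hy : U y - V y = 0
      · rw [hy, Complex.ofReal_zero, zero_mul, norm_zero]
        exact Set.indicator_nonneg (fun _ _ => by positivity) _
      · have hy' : y ∈ Set.Icc (-A) A := abs_le.1 ((hU.sub hV).abs_lt_of_ne_zero hy).le
        rw [Set.indicator_of_mem hy', norm_mul, Complex.norm_real]
        gcongr
        · exact hD y
        · exact (h y hy').trans (le_abs_self B))
    (fun y => (hlim hV hWV y).const_mul _) x
  refine tendsto_nhds_unique (((hlim hV hWV x).sub (hlim hU hWU x)).congr' ?_) hR
  filter_upwards [hevV, eventually_jostWronskian_ne_zero hU hWU] with κ h1 h2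
  exact green_sub_green_of_im_pos hV hU h1.1 h1.2 h2.2 hf2 x

theorem norm_green_le (hV : IsPotential A V) {M : ℝ} (hM : ∀ x, |V x| ≤ M) (k : ℝ) {f : ℝ → ℂ}
    (hf : Integrable f) {x : ℝ} (hx : |x| ≤ A) :
    ‖green A V k f x‖ ≤ jostBound A M * jostBound A M * (∫ y, ‖f y‖) / ‖jostWronskian A V k‖ := by
  rw [abs_le] at hx
  exact norm_mul_add_mul_integral_le hf (fun _ => (norm_jostRight_le hV hM k hx.1).1)
    (fun _ => (norm_jostLeft_le hV hM k hx.2).1) (jostBound_pos A M).le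
    (fun y hy _ => (norm_jostLeft_le hV hM k (hy.trans hx.2)).1)
    (fun y hy _ => (norm_jostRight_le hV hM k (hx.1.trans hy.le)).1)

/-- If $x<-A$ the integral multiplying $p(x)$ vanishes, and if $x>A$ the one multiplying $m(x)$
does. The surviving Jost solution is bounded at $x$ in either case. -/
theorem norm_green_le_of_support (hV : IsPotential A V) {M : ℝ} (hM : ∀ x, |V x| ≤ M) (k : ℝ)
    {g : ℝ → ℂ} (hg : Integrable g) (hs : ∀ y, g y ≠ 0 → |y| ≤ A) (x : ℝ) :
    ‖green A V k g x‖ ≤ jostBound A M * jostBound A M * (∫ y, ‖g y‖) / ‖jostWronskian A V k‖ ∧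
    ‖greenDeriv A V k g x‖ ≤
      jostBound A M * (1 + |k|) * jostBound A M * (∫ y, ‖g y‖) / ‖jostWronskian A V k‖ := by
  have hL : (∫ y in Set.Iic x, jostLeft A V k y * g y) ≠ 0 → -A ≤ x := fun h => by
    by_contra hx
    refine h (setIntegral_eq_zero_of_forall_eq_zero fun y hy => ?_)
    have : g y = 0 := by
      by_contra hne
      have := (abs_le.1 (hs y hne)).1
      linarith [Set.mem_Iic.1 hy]
    rw [this, mul_zero]
  have hR : (∫ y in Set.Ioi x, jostRight A V k y * g y) ≠ 0 → x ≤ A := fun h => by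
    by_contra hx
    refine h (setIntegral_eq_zero_of_forall_eq_zero fun y hy => ?_)
    have : g y = 0 := by
      by_contra hne
      have := (abs_le.1 (hs y hne)).2
      linarith [Set.mem_Ioi.1 hy]
    rw [this, mul_zero]
  have hB := jostBound_pos A M
  have b1 : ∀ y ≤ x, g y ≠ 0 → ‖jostLeft A V k y‖ ≤ jostBound A M := fun y _ hne =>
    (norm_jostLeft_le hV hM k (abs_le.1 (hs y hne)).2).1
  have b2 : ∀ y, x < y → g y ≠ 0 → ‖jostRight A V k y‖ ≤ jostBound A M := fun y _ hne =>
    (norm_jostRight_le hV hM k (abs_le.1 (hs y hne)).1).1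
  exact ⟨norm_mul_add_mul_integral_le hg (fun h => (norm_jostRight_le hV hM k (hL h)).1)
      (fun h => (norm_jostLeft_le hV hM k (hR h)).1) hB.le b1 b2,
    norm_mul_add_mul_integral_le hg (fun h => (norm_jostRight_le hV hM k (hL h)).2)
      (fun h => (norm_jostLeft_le hV hM k (hR h)).2) (by positivity) b1 b2⟩

/-- Pointwise bounds for the difference of two resolvents, uniform in the frequency. -/
theorem exists_bound_green_sub_green (hV : IsPotential A V) (hU : IsPotential A U) {M c d : ℝ}
    (hVM : ∀ x, |V x| ≤ M) (hUM : ∀ x, |U x| ≤ M) (hd : ∀ x, |U x - V x| ≤ d) (hc : 0 < c) {k : ℝ}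
    (hWV : c * (1 + |k|) ≤ ‖jostWronskian A V k‖) (hWU : c * (1 + |k|) ≤ ‖jostWronskian A U k‖)
    {f : ℝ → ℂ} (hf : Integrable f) (hf2 : MemLp f 2 volume) :
    ∃ u₁ u₂, IsPrimitive (fun x => green A V k f x - green A U k f x) u₁ ∧ IsPrimitive u₁ u₂ ∧
      ∀ x, ∀ w ∈ [green A V k f x - green A U k f x, u₁ x, u₂ x],
        ‖w‖ ≤ ((M + 2) * (2 * A) * (jostBound A M ^ 2 / c) ^ 2 + jostBound A M ^ 2 / c) *
          d * ∫ y, ‖f y‖ := by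
  have hA := hV.pos
  have hM0 : 0 ≤ M := (abs_nonneg _).trans (hVM 0)
  have hd0 : 0 ≤ d := (abs_nonneg _).trans (hd 0)
  have hk : 0 < c * (1 + |k|) := by positivity
  have hWV0 : jostWronskian A V k ≠ 0 := norm_pos_iff.1 (hk.trans_le hWV)
  have hWU0 : jostWronskian A U k ≠ 0 := norm_pos_iff.1 (hk.trans_le hWU)
  set F := ∫ y, ‖f y‖
  have hF : 0 ≤ F := integral_nonneg fun _ => norm_nonneg _
  set N := jostBound A M ^ 2 / c with hN
  have hBp := jostBound_pos A M
  have hN0 : 0 < N := by positivity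
  set T := 1 + |k|
  have hT1 : 1 ≤ T := by simp only [T]; linarith [abs_nonneg k]
  set g : ℝ → ℂ := fun y => ((U y - V y : ℝ) : ℂ) * green A V k f y
  have hdiv : ∀ {W : ℂ} {I : ℝ}, 0 ≤ I → c * T ≤ ‖W‖ →
      jostBound A M * jostBound A M * I / ‖W‖ ≤ N * I / T := fun {W I} hI hW => by
    calc _ ≤ jostBound A M * jostBound A M * I / (c * T) := by gcongr
      _ = N * I / T := by rw [hN]; field_simp
  have hs : ∀ y, g y ≠ 0 → |y| ≤ A := fun y hy =>
    ((hU.sub hV).abs_lt_of_ne_zero fun h => hy (by simp only [g, h]; simp)).le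
  have hgb : ∀ y, ‖g y‖ ≤ d * (N * F / T) := fun y => by
    by_cases hy : |y| ≤ A
    · simp only [g]
      rw [norm_mul, Complex.norm_real]
      exact mul_le_mul (hd y) ((norm_green_le hV hVM k hf hy).trans (hdiv hF hWV))
        (norm_nonneg _) hd0
    · rw [not_imp_comm.1 (hs y) hy, norm_zero]; positivity
  have hcV : Continuous (green A V k f) :=
    (isPrimitive_green hV (greenIntegrable_of_integrable hV (by simp) hf)).continuous
  have hcUV := (hU.sub hV).cont
  have hcg : Continuous g := by fun_prop
  have hgs : HasCompactSupport g := HasCompactSupport.intro (isCompact_Icc (a := -A) (b := A))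
    fun y hy => not_imp_comm.1 (hs y) fun h => hy (abs_le.1 h)
  have hg : Integrable g := hcg.integrable_of_hasCompactSupport hgs
  have hgI : ∫ y, ‖g y‖ ≤ 2 * A * (d * (N * F / T)) := by
    have e : ∫ y, ‖g y‖ = ∫ y in Set.Icc (-A) A, ‖g y‖ :=
      (setIntegral_eq_integral_of_forall_compl_eq_zero fun y hy => by
        rw [not_imp_comm.1 (hs y) fun h => hy (abs_le.1 h), norm_zero]).symm
    rw [e]
    have := norm_setIntegral_le_of_norm_le_const (μ := volume) (s := Set.Icc (-A) A)
      (f := fun y => ‖g y‖) (C := d * (N * F / T)) (by simp) (fun y _ => by simpa using hgb y)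
    rw [Real.norm_of_nonneg (integral_nonneg fun _ => norm_nonneg _), Measure.real,
      Real.volume_Icc, ENNReal.toReal_ofReal (by linarith)] at this
    linarith
  have hGU := greenIntegrable_of_integrable hU (κ := k) (by simp) hg
  have hid : (fun x => green A V k f x - green A U k f x) = green A U k g :=
    funext fun x => green_sub_green hV hU hWV0 hWU0 hf hf2 x
  have hG0 : 0 ≤ ∫ y, ‖g y‖ := integral_nonneg fun _ => norm_nonneg _
  set P := 2 * A * N ^ 2 * d * F with hP
  have hP0 : 0 ≤ P := by positivity
  -- One factor $1/T$ comes from $R_V$ inside $g$, the other from $R_U$ applied to $g$.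
  have hu0 : ∀ x, ‖green A U k g x‖ ≤ P / T ^ 2 := fun x => by
    refine ((norm_green_le_of_support hU hUM k hg hs x).1.trans (hdiv hG0 hWU)).trans ?_
    calc _ ≤ N * (2 * A * (d * (N * F / T))) / T := by gcongr
      _ = P / T ^ 2 := by rw [hP]; field_simp
  -- One derivative of a Jost solution costs a factor $T$.
  have hu1 : ∀ x, ‖greenDeriv A U k g x‖ ≤ P / T := fun x => by
    refine (norm_green_le_of_support hU hUM k hg hs x).2.trans ?_
    calc _ = T * (jostBound A M * jostBound A M * (∫ y, ‖g y‖) / ‖jostWronskian A U k‖) := by ring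
      _ ≤ T * (N * (2 * A * (d * (N * F / T))) / T) := by
        refine mul_le_mul_of_nonneg_left ((hdiv hG0 hWU).trans ?_) (by linarith)
        gcongr
      _ = P / T := by rw [hP]; field_simp
  have hPT : P / T ≤ P := div_le_self hP0 hT1
  have hPT2 : P / T ^ 2 ≤ P := div_le_self hP0 (one_le_pow₀ hT1)
  have hfin : ((M + 2) * (2 * A) * N ^ 2 + N) * d * F = (M + 2) * P + N * d * F := by
    rw [hP]; ring
  have hNdF : 0 ≤ N * d * F := by positivity
  have hMP : 0 ≤ M * P := by positivity
  rw [hid]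
  refine ⟨_, _, isPrimitive_green hU hGU, isPrimitive_greenDeriv hU hGU hWU0, fun x w hw => ?_⟩
  rw [hfin]
  have hid' := congrFun hid x
  simp only [List.mem_cons, List.not_mem_nil, or_false] at hw
  rcases hw with rfl | rfl | rfl
  · rw [hid']
    linarith [hu0 x]
  · linarith [hu1 x]
  · have h1 : ‖(U x : ℂ) * green A U k g x‖ ≤ M * P := by
      rw [norm_mul, Complex.norm_real]
      exact mul_le_mul (hUM x) ((hu0 x).trans hPT2) (norm_nonneg _) hM0
    -- The factor $k^2$ in the second derivative is absorbed by $T^{-2}$; with a single resolvent in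
    -- place of two it would not be.
    have h2 : ‖(k : ℂ) ^ 2 * green A U k g x‖ ≤ P := by
      rw [norm_mul, norm_pow, Complex.norm_real, Real.norm_eq_abs]
      calc |k| ^ 2 * ‖green A U k g x‖ ≤ T ^ 2 * (P / T ^ 2) := by
            gcongr
            · simp only [T]; linarith
            · exact hu0 x
        _ = P := by field_simp
    have h3 : ‖g x‖ ≤ N * d * F := (hgb x).trans (by
      rw [mul_div_assoc']
      refine (div_le_self (by positivity) hT1).trans (le_of_eq (by ring)))
    have := norm_sub_le_of_le (norm_sub_le_of_le h1 h2) h3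
    linarith

end

/-! ### Weighted spaces -/

theorem one_add_sq_abs_pos (x : ℝ) : 0 < 1 + |x| ^ 2 := by positivity

/-- The logarithmic derivative $p=2tx/(1+x^2)$ of the weight $w$ satisfies $|p|\le|t|$ and
$|p'|\le2|t|$, while $w'=pw$ and $w''=(p'+p^2)w$. -/
theorem exists_weight_derivatives (t : ℝ) : ∃ (c : ℝ) (w₁ w₂ : ℝ → ℝ), 1 ≤ c ∧ Continuous w₁ ∧
    Continuous w₂ ∧ (∀ x : ℝ, HasDerivAt (fun x : ℝ => (1 + |x| ^ 2) ^ t) (w₁ x) x) ∧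
    (∀ x, HasDerivAt w₁ (w₂ x) x) ∧
    ∀ x, |w₁ x| ≤ c * (1 + |x| ^ 2) ^ t ∧ |w₂ x| ≤ c * (1 + |x| ^ 2) ^ t := by
  simp only [sq_abs]
  have hpos : ∀ x : ℝ, 0 < 1 + x ^ 2 := fun x => by positivity
  have hne : ∀ x : ℝ, 1 + x ^ 2 ≠ 0 := fun x => (hpos x).ne'
  set w : ℝ → ℝ := fun x => (1 + x ^ 2) ^ t
  set p : ℝ → ℝ := fun x => 2 * t * x / (1 + x ^ 2)
  set p' : ℝ → ℝ := fun x => 2 * t * (1 - x ^ 2) / (1 + x ^ 2) ^ 2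
  have hsq : ∀ x : ℝ, HasDerivAt (fun x : ℝ => 1 + x ^ 2) (2 * x) x := fun x => by
    simpa using (hasDerivAt_pow 2 x).const_add 1
  have hw : ∀ x, HasDerivAt w (p x * w x) x := fun x => by
    have := (hsq x).rpow_const (p := t) (.inl (hne x))
    convert! this using 1
    simp only [p, w]
    rw [Real.rpow_sub_one (hne x)]
    ring
  have hp : ∀ x, HasDerivAt p (p' x) x := fun x => by
    have := ((hasDerivAt_id x).const_mul (2 * t)).div (hsq x) (hne x)
    convert! this using 1
    simp only [p', id]
    ring
  have hwc : Continuous w := continuous_iff_continuousAt.2 fun x => (hw x).continuousAt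
  have hpc : Continuous p := continuous_iff_continuousAt.2 fun x => (hp x).continuousAt
  have hpc' : Continuous p' :=
    Continuous.div (by fun_prop) (by fun_prop) fun x => pow_ne_zero 2 (hne x)
  have hw0 : ∀ x, 0 ≤ w x := fun x => Real.rpow_nonneg (hpos x).le t
  have hpb : ∀ x, |p x| ≤ |t| := fun x => by
    simp only [p]
    rw [abs_div, abs_of_pos (hpos x), div_le_iff₀ (hpos x), abs_mul, abs_mul, abs_two]
    have : 2 * |x| ≤ 1 + x ^ 2 := by nlinarith [sq_nonneg (|x| - 1), sq_abs x]
    nlinarith [abs_nonneg t]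
  have hpb' : ∀ x, |p' x| ≤ 2 * |t| := fun x => by
    have h2 : 0 < (1 + x ^ 2) ^ 2 := by positivity
    simp only [p']
    rw [abs_div, abs_of_pos h2, div_le_iff₀ h2, abs_mul, abs_mul, abs_two]
    have : |1 - x ^ 2| ≤ (1 + x ^ 2) ^ 2 := by
      rw [abs_le]
      constructor <;> nlinarith [sq_nonneg x, sq_nonneg (x ^ 2)]
    gcongr
  refine ⟨1 + 2 * |t| + |t| ^ 2, fun x => p x * w x, fun x => p' x * w x + p x * (p x * w x), ?_,
    hpc.mul hwc, (hpc'.mul hwc).add (hpc.mul (hpc.mul hwc)), hw, fun x => (hp x).mul (hw x),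
    fun x => ⟨?_, ?_⟩⟩
  · have := abs_nonneg t
    nlinarith [sq_nonneg |t|]
  · rw [abs_mul, abs_of_nonneg (hw0 x)]
    refine mul_le_mul_of_nonneg_right ?_ (hw0 x)
    nlinarith [hpb x, abs_nonneg t, sq_nonneg |t|]
  · have : p' x * w x + p x * (p x * w x) = (p' x + p x ^ 2) * w x := by ring
    simp only [this]
    rw [abs_mul, abs_of_nonneg (hw0 x)]
    refine mul_le_mul_of_nonneg_right ((abs_add_le _ _).trans ?_) (hw0 x)
    have h1 : |p x ^ 2| ≤ |t| ^ 2 := by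
      rw [abs_pow]; exact pow_le_pow_left₀ (abs_nonneg _) (hpb x) 2
    linarith [hpb' x]

theorem continuous_weight (t : ℝ) : Continuous fun x : ℝ => (1 + |x| ^ 2) ^ t :=
  Continuous.rpow_const (by fun_prop) fun x => .inl (one_add_sq_abs_pos x).ne'

/-- The square of the weight is $(1+x^2)^{-s}$, integrable because $2s>1$. -/
theorem memLp_weight {s : ℝ} (hs : 1 / 2 < s) :
    MemLp (fun x : ℝ => (1 + |x| ^ 2) ^ (-s / 2)) 2 volume := by
  refine (memLp_two_iff_integrable_sq (continuous_weight _).aestronglyMeasurable).2 ?_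
  have := integrable_rpow_neg_one_add_norm_sq (E := ℝ) (μ := volume) (r := 2 * s)
    (by simp; linarith)
  refine this.congr (ae_of_all _ fun x => ?_)
  simp only [Real.norm_eq_abs]
  rw [← Real.rpow_mul_natCast (one_add_sq_abs_pos x).le]
  congr 1
  push_cast; ring

theorem lpNorm_le_of_ae_le {f : ℝ → ℂ} {g : ℝ → ℝ} (hf : AEStronglyMeasurable f volume)
    (hg : MemLp g 2 volume) (h : ∀ᵐ x, ‖f x‖ ≤ g x) : lpNorm f 2 volume ≤ lpNorm g 2 volume := by
  rw [← toReal_eLpNorm hf, ← toReal_eLpNorm hg.1]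
  exact ENNReal.toReal_mono hg.2.ne (eLpNorm_mono_ae_real h)

theorem lpNorm_congr {f g : ℝ → ℂ} (h : f =ᵐ[volume] g) : lpNorm f 2 volume = lpNorm g 2 volume := by
  by_cases hf : AEStronglyMeasurable f volume
  · rw [← toReal_eLpNorm hf, ← toReal_eLpNorm (hf.congr h), eLpNorm_congr_ae h]
  · rw [lpNorm_of_not_aestronglyMeasurable hf,
      lpNorm_of_not_aestronglyMeasurable fun hg => hf (hg.congr h.symm)]

theorem lpNorm_const_mul_weight {s K : ℝ} (hK : 0 ≤ K) :
    lpNorm (fun x : ℝ => K * (1 + |x| ^ 2) ^ (-s / 2)) 2 volume =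
      K * lpNorm (fun x : ℝ => (1 + |x| ^ 2) ^ (-s / 2)) 2 volume := by
  have := lpNorm_const_smul (p := 2) K (fun x : ℝ => (1 + |x| ^ 2) ^ (-s / 2)) volume
  simpa [Pi.smul_def, abs_of_nonneg hK] using this

theorem weighted_congr {s : ℝ} {u v : ℝ → ℂ} (h : u =ᵐ[volume] v) :
    weighted s u =ᵐ[volume] weighted s v := by
  filter_upwards [h] with x hx
  rw [weighted, weighted, hx]

theorem norm_weighted (s : ℝ) (u : ℝ → ℂ) (x : ℝ) :
    ‖weighted s u x‖ = (1 + |x| ^ 2) ^ (s / 2) * ‖u x‖ := by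
  rw [weighted, norm_mul, Complex.norm_real, Real.norm_eq_abs,
    abs_of_nonneg (Real.rpow_nonneg (one_add_sq_abs_pos x).le _)]

theorem memWeightedL2_of_norm_le {s K : ℝ} (hs : 1 / 2 < s) {u : ℝ → ℂ}
    (hm : AEStronglyMeasurable u volume) (hu : ∀ x, ‖u x‖ ≤ K) : MemWeightedL2 (-s) u := by
  have hc := continuous_weight (-s / 2)
  refine (memLp_weight hs).of_le_mul (c := K)
    ((by fun_prop : Continuous fun x : ℝ => (((1 + |x| ^ 2) ^ (-s / 2) : ℝ) : ℂ)).aestronglyMeasurable.mul hm)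
    (ae_of_all _ fun x => ?_)
  have hw := Real.rpow_nonneg (one_add_sq_abs_pos x).le (-s / 2)
  rw [norm_weighted, Real.norm_eq_abs, abs_of_nonneg hw, mul_comm]
  gcongr
  exact hu x

/-- Bounded functions with bounded derivatives lie in the weighted Sobolev space. -/
theorem exists_weightedSobolevNorm_le {s : ℝ} (hs : 1 / 2 < s) : ∃ c, 0 ≤ c ∧
    ∀ (T u u₁ u₂ : ℝ → ℂ) (K : ℝ), 0 ≤ K → T =ᵐ[volume] u → IsPrimitive u u₁ →
      IsPrimitive u₁ u₂ → (∀ x, ‖u x‖ ≤ K) → (∀ x, ‖u₁ x‖ ≤ K) → (∀ x, ‖u₂ x‖ ≤ K) →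
      MemWeightedSobolev 2 (-s) T ∧ weightedSobolevNorm 2 (-s) T ≤ c * K := by
  obtain ⟨c, w₁, w₂, hc, hw₁, hw₂, hd, hd₁, hb⟩ := exists_weight_derivatives (-s / 2)
  set w : ℝ → ℝ := fun x => (1 + |x| ^ 2) ^ (-s / 2)
  set n := lpNorm w 2 volume
  have hn : 0 ≤ n := lpNorm_nonneg
  have hw0 : ∀ x, 0 ≤ w x := fun x => Real.rpow_nonneg (one_add_sq_abs_pos x).le _
  -- The Leibniz rule for $(wu)''$ has four terms, each at most $cKw$. The factor $2$ covers
  -- $\sqrt3$ from the three summands of the Sobolev norm.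
  refine ⟨2 * (4 * c * n), by positivity, fun T u u₁ u₂ K hK hT h1 h2 b0 b1 b2 => ⟨⟨?_, ?_⟩, ?_⟩⟩
  · exact (h1.hasWeakDeriv.congr hT.symm (ae_eq_refl _)).hasWeakDerivsUpTo_two h2.hasWeakDeriv
  · have hW := h1.hasWeakDeriv.congr hT.symm (ae_eq_refl _)
    intro j hj
    have key : ∀ {g v : ℝ → ℂ}, g =ᵐ[volume] v → AEStronglyMeasurable v volume →
        (∀ x, ‖v x‖ ≤ K) → MemWeightedL2 (-s) g := fun hgv hv hvK =>
      (memLp_congr_ae (weighted_congr hgv)).2 (memWeightedL2_of_norm_le hs hv hvK)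
    interval_cases j
    · exact key hT h1.continuous.aestronglyMeasurable b0
    · exact key hW.weakDeriv_ae_eq h2.continuous.aestronglyMeasurable b1
    · exact key (hW.weakDeriv_two_ae_eq h2.hasWeakDeriv) h2.1.aestronglyMeasurable b2
  · have hwc : Continuous w := continuous_weight _
    have q1 := IsPrimitive.smul hd hw₁ h1
    have q2 := (IsPrimitive.smul hd₁ hw₂ h1).add (IsPrimitive.smul hd hw₁ h2)
    have hWT : (fun x => w x • u x) =ᵐ[volume] weighted (-s) T := by
      filter_upwards [hT] with x hx
      rw [weighted, hx, Complex.real_smul]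
    have g1 := q1.hasWeakDeriv.congr hWT (ae_eq_refl _)
    have key : ∀ {g v : ℝ → ℂ}, g =ᵐ[volume] v → AEStronglyMeasurable v volume →
        (∀ x, ‖v x‖ ≤ 4 * c * K * w x) → lpNorm g 2 volume ≤ 4 * c * K * n := fun hgv hv hvK => by
      rw [lpNorm_congr hgv, ← lpNorm_const_mul_weight (by positivity)]
      exact lpNorm_le_of_ae_le hv ((memLp_weight hs).const_mul _) (ae_of_all _ hvK)
    have hsm : ∀ (a : ℝ) (z : ℂ) (x b : ℝ), |a| ≤ b * w x → 0 ≤ b → ‖z‖ ≤ K →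
        ‖a • z‖ ≤ b * K * w x := fun a z x b ha hb0 hz => by
      rw [norm_smul, Real.norm_eq_abs]
      calc |a| * ‖z‖ ≤ b * w x * K := mul_le_mul ha hz (norm_nonneg _) (mul_nonneg hb0 (hw0 x))
        _ = b * K * w x := by ring
    have hwa : ∀ x, |w x| ≤ c * w x := fun x => by
      rw [abs_of_nonneg (hw0 x)]
      exact le_mul_of_one_le_left (hw0 x) hc
    have hKw : ∀ x, 0 ≤ c * K * w x := fun x => mul_nonneg (by positivity) (hw0 x)
    have l0 := key hWT.symm q1.continuous.aestronglyMeasurable fun x => by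
      have := hsm _ _ x c (hwa x) (by linarith) (b0 x)
      linarith [hKw x]
    have l1 := key g1.weakDeriv_ae_eq q2.continuous.aestronglyMeasurable fun x => by
      have t1 := hsm _ _ x c (hb x).1 (by linarith) (b0 x)
      have t2 := hsm _ _ x c (hwa x) (by linarith) (b1 x)
      have := norm_add_le_of_le t1 t2
      linarith [hKw x]
    have l2 := key (g1.weakDeriv_two_ae_eq q2.hasWeakDeriv) q2.1.aestronglyMeasurable fun x => by
      have t1 := hsm _ _ x c (hb x).2 (by linarith) (b0 x)
      have t2 := hsm _ _ x c (hb x).1 (by linarith) (b1 x)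
      have t3 := hsm _ _ x c (hwa x) (by linarith) (b2 x)
      have := norm_add_le_of_le (norm_add_le_of_le t1 t2) (norm_add_le_of_le t2 t3)
      linarith [hKw x]
    have hL : 0 ≤ 4 * c * K * n := by positivity
    rw [weightedSobolevNorm, sobolevNorm]
    refine Real.sqrt_le_iff.2 ⟨by positivity, ?_⟩
    rw [Finset.sum_range_succ, Finset.sum_range_succ, Finset.sum_range_one]
    have p0 := pow_le_pow_left₀ lpNorm_nonneg l0 2
    have p1 := pow_le_pow_left₀ lpNorm_nonneg l1 2
    have p2 := pow_le_pow_left₀ lpNorm_nonneg l2 2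
    simp only [Function.iterate_zero, id, Function.iterate_one]
    nlinarith [sq_nonneg (4 * c * K * n)]

/-- Cauchy–Schwarz for $f=w\cdot w^{-1}f$ with $w=(1+x^2)^{-s/2}\in L^2$; membership in $L^2$
follows from $w\le1$. -/
theorem exists_integral_norm_le {s : ℝ} (hs : 1 / 2 < s) : ∃ c, 0 ≤ c ∧ ∀ f, MemWeightedL2 s f →
    Integrable f ∧ MemLp f 2 volume ∧ ∫ x, ‖f x‖ ≤ c * weightedL2Norm s f := by
  set w : ℝ → ℝ := fun x => (1 + |x| ^ 2) ^ (-s / 2)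
  have hw : MemLp w 2 volume := memLp_weight hs
  have hw0 : ∀ x, 0 ≤ w x := fun x => Real.rpow_nonneg (one_add_sq_abs_pos x).le _
  have hw1 : ∀ x, w x ≤ 1 := fun x => by
    have h1 : (1 : ℝ) ≤ 1 + |x| ^ 2 := by nlinarith [sq_nonneg |x|]
    exact Real.rpow_le_one_of_one_le_of_nonpos h1 (by linarith)
  refine ⟨lpNorm w 2 volume, lpNorm_nonneg, fun f hf => ?_⟩
  have hfw : f = fun x => ((w x : ℝ) : ℂ) * weighted s f x := funext fun x => by
    simp only [w, weighted]
    rw [← mul_assoc, ← Complex.ofReal_mul, ← Real.rpow_add (one_add_sq_abs_pos x), neg_div,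
      neg_add_cancel, Real.rpow_zero, Complex.ofReal_one, one_mul]
  have hnorm : ∀ x, ‖f x‖ = w x * ‖weighted s f x‖ := fun x => by
    conv_lhs => rw [hfw]
    rw [norm_mul, Complex.norm_real, Real.norm_eq_abs, abs_of_nonneg (hw0 x)]
  have hwC : MemLp (fun x => ((w x : ℝ) : ℂ)) 2 volume := hw.ofReal
  have hint : Integrable f := by
    rw [hfw]
    exact hwC.integrable_mul hf
  refine ⟨hint, hf.mono hint.1 (ae_of_all _ fun x => ?_), ?_⟩
  · rw [hnorm]
    exact mul_le_of_le_one_left (norm_nonneg _) (hw1 x)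
  · simp only [hnorm]
    have h := integral_mul_le_Lp_mul_Lq_of_nonneg (μ := volume) Real.HolderConjugate.two_two
      (ae_of_all _ hw0) (ae_of_all _ fun x => norm_nonneg (weighted s f x))
      (by simpa using hw) (by simpa using hf.norm)
    refine h.trans (le_of_eq ?_)
    rw [weightedL2Norm, lpNorm_eq_integral_norm_rpow_toReal two_ne_zero ENNReal.ofNat_ne_top hw.1,
      lpNorm_eq_integral_norm_rpow_toReal two_ne_zero ENNReal.ofNat_ne_top hf.1]
    simp [abs_of_nonneg (hw0 _)]

/-! ### Continuous representatives and conclusion -/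

theorem Continuous.forall_le_of_ae_le {g : ℝ → ℝ} (hg : Continuous g) {d : ℝ}
    (h : ∀ᵐ x, g x ≤ d) (x : ℝ) : g x ≤ d := by
  have hz : volume {x | d < g x} = 0 := by
    simpa [ae_iff] using h
  have := (isOpen_lt continuous_const hg).eq_empty_of_measure_zero hz
  exact not_lt.1 fun hx => (this ▸ hx : x ∈ (∅ : Set ℝ))

/-- A compactly supported potential in `H¹` has a continuous representative. -/
theorem exists_isPotential {a : ℝ} {V : ℝ → ℝ} (hs : ∀ᵐ x : ℝ, a < |x| → V x = 0)
    (hV : MemSobolevSpace 1 V) : ∃ V₀, IsPotential (|a| + 1) V₀ ∧ V =ᵐ[volume] V₀ := by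
  obtain ⟨V₀, hP, he⟩ := (hV.1 0 one_pos).exists_isPrimitive
  have hc := hP.continuous
  -- The radius $|a|+1$ is positive for every real $a$ and exceeds $a$, so $|x|\ge|a|+1$ lies in the
  -- open region where the continuous representative vanishes.
  refine ⟨V₀, ⟨by positivity, hc, fun x hx => ?_⟩, he⟩
  have ho : IsOpen {x : ℝ | a < |x| ∧ V₀ x ≠ 0} :=
    (isOpen_lt continuous_const continuous_abs).inter (isOpen_ne_fun hc continuous_const)
  have hz : volume {x : ℝ | a < |x| ∧ V₀ x ≠ 0} = 0 := by
    have : ∀ᵐ x : ℝ, ¬ (a < |x| ∧ V₀ x ≠ 0) := by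
      filter_upwards [hs, he] with x h1 h2 h3
      exact h3.2 (h2 ▸ h1 h3.1)
    simpa only [ae_iff, not_not] using! this
  by_contra hne
  have : x ∈ (∅ : Set ℝ) := (ho.eq_empty_of_measure_zero hz) ▸
    (⟨by linarith [le_abs_self a], hne⟩ : a < |x| ∧ V₀ x ≠ 0)
  exact this

/-- The equation sees $V$ only up to null sets. An equality of predicates, rather than an
equivalence, makes the choices in the resolvents coincide literally. -/
theorem solvesSchrodinger_congr {V V₀ : ℝ → ℝ} (h : V =ᵐ[volume] V₀) :
    SolvesSchrodinger V = SolvesSchrodinger V₀ := by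
  funext z f u
  refine propext (and_congr_right fun _ => ?_)
  constructor <;> intro hu <;> filter_upwards [h, hu] with x h1 h2 <;> rw [← h2, h1]

theorem isOutgoingLimit_congr {V V₀ : ℝ → ℝ} (h : V =ᵐ[volume] V₀) :
    IsOutgoingLimit V = IsOutgoingLimit V₀ := by
  have h1 : InResolventSet V = InResolventSet V₀ := by
    unfold InResolventSet; rw [solvesSchrodinger_congr h]
  have h2 : schrodingerResolvent V = schrodingerResolvent V₀ := by
    unfold schrodingerResolvent; rw [solvesSchrodinger_congr h]
  unfold IsOutgoingLimit
  rw [h1, h2]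

theorem outgoingResolvent_congr {V V₀ : ℝ → ℝ} (h : V =ᵐ[volume] V₀) :
    outgoingResolvent V = outgoingResolvent V₀ := by
  unfold outgoingResolvent
  rw [isOutgoingLimit_congr h]

theorem IsExceptional.congr {V V₀ : ℝ → ℝ} (h : V₀ =ᵐ[volume] V) (hE : IsExceptional V₀) :
    IsExceptional V := by
  obtain ⟨η, η', h1, h2, h3, h4⟩ := hE
  refine ⟨η, η', h1, h2, h3, h4.congr (ae_eq_refl _) ?_⟩
  filter_upwards [h] with x hx
  rw [hx]

theorem abs_sub_le_supDist {A : ℝ} {V U V₀ U₀ : ℝ → ℝ} (hV : IsPotential A V₀)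
    (hU : IsPotential A U₀) (hVe : V =ᵐ[volume] V₀) (hUe : U =ᵐ[volume] U₀) (x : ℝ) :
    |U₀ x - V₀ x| ≤ supDist V U := by
  obtain ⟨D, -, hD⟩ := (hV.sub hU).exists_bound
  have he : V - U =ᵐ[volume] fun x => V₀ x - U₀ x := hVe.sub hUe
  -- Without measurability `lpNorm` would be the default `0` and bound nothing.
  have hm : MemLp (V - U) ⊤ volume := (memLp_congr_ae he).2
    (memLp_top_of_bound (hV.sub hU).cont.aestronglyMeasurable D (ae_of_all _ hD))
  refine Continuous.forall_le_of_ae_le (hU.sub hV).cont.abs ?_ x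
  filter_upwards [ae_le_lpNorm_exponent_top hm, he] with y h1 h2
  rw [h2, Real.norm_eq_abs, abs_sub_comm] at h1
  exact h1

/-- The radius and the constant are quantified before the hypotheses on $V$, so that they can be
extracted as functions of $a$, $V$ and $s$ alone. -/
theorem exists_opNormLE (a : ℝ) (V : ℝ → ℝ) : ∃ (ρ₀ : ℝ) (C : ℝ → ℝ), 0 < ρ₀ ∧
    ((∀ᵐ x : ℝ, a < |x| → V x = 0) → MemSobolevSpace 1 V → ¬ IsExceptional V →
      ∀ U, (∀ᵐ x : ℝ, a < |x| → U x = 0) → MemSobolevSpace 1 U → supDist V U < ρ₀ →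
        ∀ s : ℝ, 1 / 2 < s → ∀ k : ℝ,
          (∀ f : ℝ → ℂ, MemWeightedL2 s f →
            IsOutgoingLimit V k f (outgoingResolvent V k f) ∧
            IsOutgoingLimit U k f (outgoingResolvent U k f)) ∧
          OpNormLE s 2 (-s) (fun f => outgoingResolvent V k f - outgoingResolvent U k f)
            (C s * supDist V U)) := by
  by_cases hyp : (∀ᵐ x : ℝ, a < |x| → V x = 0) ∧ MemSobolevSpace 1 V ∧ ¬ IsExceptional V
  swap
  -- Default values for potentials that do not satisfy the hypotheses.
  · exact ⟨1, 0, one_pos, fun h1 h2 h3 => (hyp ⟨h1, h2, h3⟩).elim⟩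
  obtain ⟨hs, hH, hE⟩ := hyp
  obtain ⟨V₀, hV, hVe⟩ := exists_isPotential hs hH
  set A := |a| + 1
  have hW0 : jostWronskian A V₀ 0 ≠ 0 := fun h =>
    hE ((isExceptional_of_jostWronskian_eq_zero hV h).congr hVe.symm)
  obtain ⟨ρ, hρ, c, hc, hlow⟩ := exists_norm_jostWronskian_ge hV hW0
  obtain ⟨M, hM0, hM⟩ := hV.exists_bound
  -- $M+\rho$ bounds every potential within distance $\rho$ of $V$, so the constant does not depend
  -- on $U$.
  set N := jostBound A (M + ρ) ^ 2 / c
  set K := (M + ρ + 2) * (2 * A) * N ^ 2 + N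
  have hA := hV.pos
  have hB := jostBound_pos A (M + ρ)
  have hK : 0 ≤ K := by positivity
  choose! c₁ hc₁ hS using fun s (hs : 1 / 2 < s) => exists_weightedSobolevNorm_le hs
  choose! c₂ hc₂ hI using fun s (hs : 1 / 2 < s) => exists_integral_norm_le hs
  refine ⟨ρ, fun s => c₁ s * (K * c₂ s), hρ, fun _ _ _ U hUs hUH hUρ s hs k => ?_⟩
  obtain ⟨U₀, hU, hUe⟩ := exists_isPotential hUs hUH
  have hd := abs_sub_le_supDist hV hU hVe hUe
  set d := supDist V U
  have hd0 : 0 ≤ d := (abs_nonneg _).trans (hd 0)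
  have hWV := hlow V₀ hV (fun x => by simpa using hρ.le) k
  have hWU := hlow U₀ hU (fun x => (hd x).trans hUρ.le) k
  have hpos : 0 < c * (1 + |k|) := by positivity
  have hWV0 : jostWronskian A V₀ k ≠ 0 := norm_pos_iff.1 (hpos.trans_le hWV)
  have hWU0 : jostWronskian A U₀ k ≠ 0 := norm_pos_iff.1 (hpos.trans_le hWU)
  have hUM : ∀ x, |U₀ x| ≤ M + ρ := fun x => by
    have := abs_add_le (U₀ x - V₀ x) (V₀ x)
    rw [sub_add_cancel] at this
    linarith [hd x, hM x]
  rw [isOutgoingLimit_congr hVe, isOutgoingLimit_congr hUe, outgoingResolvent_congr hVe,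
    outgoingResolvent_congr hUe]
  constructor
  · intro f hf
    obtain ⟨f1, f2, -⟩ := hI s hs f hf
    exact ⟨(outgoingResolvent_spec hV hWV0 f1 f2).1, (outgoingResolvent_spec hU hWU0 f1 f2).1⟩
  · intro f hf
    obtain ⟨f1, f2, f3⟩ := hI s hs f hf
    obtain ⟨u₁, u₂, p1, p2, hb⟩ := exists_bound_green_sub_green hV hU
      (fun x => (hM x).trans (by linarith)) hUM hd hc hWV hWU f1 f2
    have hF : 0 ≤ ∫ y, ‖f y‖ := integral_nonneg fun _ => norm_nonneg _
    have hT : outgoingResolvent V₀ k f - outgoingResolvent U₀ k f =ᵐ[volume]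
        fun x => green A V₀ k f x - green A U₀ k f x :=
      (outgoingResolvent_spec hV hWV0 f1 f2).2.sub (outgoingResolvent_spec hU hWU0 f1 f2).2
    obtain ⟨r1, r2⟩ := hS s hs _ _ u₁ u₂ (K * d * ∫ y, ‖f y‖) (by positivity) hT p1 p2
      (fun x => hb x _ (by simp)) (fun x => hb x _ (by simp)) (fun x => hb x _ (by simp))
    refine ⟨r1, r2.trans ?_⟩
    have h1 := hc₁ s hs
    calc c₁ s * (K * d * ∫ y, ‖f y‖) ≤ c₁ s * (K * d * (c₂ s * weightedL2Norm s f)) := by gcongr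
      _ = c₁ s * (K * c₂ s) * d * weightedL2Norm s f := by ring

theorem mainTheorem5 :
    ∃ C : (ℝ → ℝ) → ℝ → ℝ → ℝ → ℝ,
      ∀ (a b μ : ℝ) (V : ℝ → ℝ), IsAdmissible a b μ V → ¬ IsExceptional V →
        ∃ ρ₀ : ℝ, 0 < ρ₀ ∧
          ∀ U ∈ admissibleBall a b μ V ρ₀, ∀ s : ℝ, 1 / 2 < s → ∀ k : ℝ,
            (∀ f : ℝ → ℂ, MemWeightedL2 s f →
              IsOutgoingLimit V k f (outgoingResolvent V k f) ∧
              IsOutgoingLimit U k f (outgoingResolvent U k f)) ∧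
            OpNormLE s 2 (-s) (fun f => outgoingResolvent V k f - outgoingResolvent U k f)
              (C V ρ₀ a s * supDist V U) := by
  choose ρ C hρ h using exists_opNormLE
  -- The radius argument is discarded because the radius is itself a function of $a$ and $V$.
  exact ⟨fun V _ a s => C a V s, fun a b μ V hV hE => ⟨ρ a V, hρ a V, fun U hU =>
    h a V hV.support_subset hV.memSobolev hE U hU.1.support_subset hU.1.memSobolev hU.2⟩⟩
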